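/- A correlation graph is a finite vertex set $V$ in which every pair of distinct vertices is coloured either blue or red; in an incomplete correlation graph some pairs may be left uncoloured (non-edges). A permissive vertex split of a vertex $v$ replaces $v$ by two new vertices $v_1,v_2$ such that every blue neighbour of $v$ is a blue neighbour of at least one of $v_1,v_2$ and every red neighbour of $v$ is a red neighbour of at least one of $v_1,v_2$; all other edges incident to $v_1$ and $v_2$ are chosen arbitrarily, and edges not incident to $v$ are unchanged. An erroneous cycle is a simple cycle of coloured edges with exactly one red edge, and a sequence of splits clusters $G$ if the graph it produces has no erroneous cycle. Cluster Editing with Permissive Vertex Splitting asks, for a correlation graph $G$, for a shortest sequence of permissive vertex splits that clusters $G$; let $\mathrm{opt}(G)$ be its length, where the intermediate and final graphs are allowed to be incomplete. Theorem. Cluster Editing with Permissive Vertex Splitting admits a polynomial-time $7$-approximation: there are an algorithm (a program of a random access machine with addition and truncated subtraction, each elementary operation counted as one step) and a polynomial $p$ such that, for every correlation graph $G$ on $n$ vertices, given by its coloured adjacency matrix, the algorithm halts after at most $p(n)$ steps and outputs an explicit sequence of at most $7\cdot\mathrm{opt}(G)$ permissive vertex splits that clusters $G$; moreover every graph occurring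 in this sequence is a (complete) correlation graph. -/

import Mathlib

namespace PVS

/-! ### Correlation graphs and permissive vertex splits -/

/-- An incomplete correlation graph on the vertices `0, …, n - 1`: a simple graph whose edges are
coloured blue or red (a pair of vertices that is neither blue nor red is a non-edge). -/
structure CorrelationGraph (n : ℕ) where
  blue : SimpleGraph (Fin n)
  red : SimpleGraph (Fin n)
  disjoint : Disjoint blue red

/-- A correlation graph proper: every pair of distinct vertices is a blue or a red edge. -/
def CorrelationGraph.IsComplete {n : ℕ} (G : CorrelationGraph n) : Prop :=
  G.blue ⊔ G.red = ⊤

/-- `G` contains an erroneous cycle: a simple cycle (of coloured edges) with exactly one red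
edge. -/
def CorrelationGraph.HasErroneousCycle {n : ℕ} (G : CorrelationGraph n) : Prop :=
  ∃ (u : Fin n) (c : (G.blue ⊔ G.red).Walk u u),
    c.IsCycle ∧ ∃! e : Sym2 (Fin n), e ∈ c.edges ∧ e ∈ G.red.edgeSet

/-- `G'` arises from `G` by a permissive vertex split of `v`. The first copy of `v` takes over the
number of `v`, the second copy gets the new number `n`; all other vertices keep their numbers.
Every red (blue) neighbour of `v` is a red (blue) neighbour of at least one copy, edges not
incident to `v` are unchanged, and all further edges at the two copies are arbitrary. -/
structure IsSplit {n : ℕ} (G : CorrelationGraph n) (v : Fin n) (G' : CorrelationGraph (n + 1)) :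
    Prop where
  blue_unchanged : ∀ a b : Fin n, a ≠ v → b ≠ v →
    (G'.blue.Adj a.castSucc b.castSucc ↔ G.blue.Adj a b)
  red_unchanged : ∀ a b : Fin n, a ≠ v → b ≠ v →
    (G'.red.Adj a.castSucc b.castSucc ↔ G.red.Adj a b)
  blue_kept : ∀ a : Fin n, G.blue.Adj v a →
    G'.blue.Adj v.castSucc a.castSucc ∨ G'.blue.Adj (Fin.last n) a.castSucc
  red_kept : ∀ a : Fin n, G.red.Adj v a →
    G'.red.Adj v.castSucc a.castSucc ∨ G'.red.Adj (Fin.last n) a.castSucc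

/-- Sequences of permissive vertex splits that start at a graph `G` and end in a graph `H`. -/
inductive SplitSeq : {n m : ℕ} → CorrelationGraph n → CorrelationGraph m → Type
  | nil {n : ℕ} (G : CorrelationGraph n) : SplitSeq G G
  | cons {n m : ℕ} {G : CorrelationGraph n} {H : CorrelationGraph m} (v : Fin n)
      (G' : CorrelationGraph (n + 1)) (h : IsSplit G v G') (σ : SplitSeq G' H) : SplitSeq G H

/-- The number of splits in a sequence. -/
def SplitSeq.length : {n m : ℕ} → {G : CorrelationGraph n} → {H : CorrelationGraph m} →
    SplitSeq G H → ℕ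
  | _, _, _, _, .nil _ => 0
  | _, _, _, _, .cons _ _ _ σ => σ.length + 1

/-- Every split of the sequence produces a complete correlation graph. -/
def SplitSeq.StaysComplete : {n m : ℕ} → {G : CorrelationGraph n} → {H : CorrelationGraph m} →
    SplitSeq G H → Prop
  | _, _, _, _, .nil _ => True
  | _, _, _, _, .cons _ G' _ σ => G'.IsComplete ∧ σ.StaysComplete

/-- The sequence clusters its initial graph: the resulting graph has no erroneous cycle. -/
def SplitSeq.Clusters {n m : ℕ} {G : CorrelationGraph n} {H : CorrelationGraph m}
    (_σ : SplitSeq G H) : Prop :=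
  ¬ H.HasErroneousCycle

/-! ### Encodings as lists of numbers -/

open Classical in
/-- Row `a` of the coloured adjacency matrix: `1` for blue, `2` for red, `0` for no edge. -/
noncomputable def CorrelationGraph.row {n : ℕ} (G : CorrelationGraph n) (a : Fin n) : List ℕ :=
  List.ofFn fun b : Fin n => if G.blue.Adj a b then 1 else if G.red.Adj a b then 2 else 0

/-- A graph is written as its number of vertices followed by the rows of its matrix. -/
noncomputable def CorrelationGraph.encode {n : ℕ} (G : CorrelationGraph n) : List ℕ :=
  n :: (List.ofFn G.row).flatten

/-- Each split is written as the split vertex followed by the rows, in the new graph, of its two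
copies (the rest of the new graph is inherited from the old one). -/
noncomputable def SplitSeq.encodeSteps : {n m : ℕ} → {G : CorrelationGraph n} →
    {H : CorrelationGraph m} → SplitSeq G H → List ℕ
  | _, _, _, _, .nil _ => []
  | n, _, _, _, .cons v G' _ σ =>
      (v : ℕ) :: (G'.row v.castSucc ++ G'.row (Fin.last n) ++ σ.encodeSteps)

/-- A sequence of splits is written as its length followed by its splits in order. -/
noncomputable def SplitSeq.encode {n m : ℕ} {G : CorrelationGraph n} {H : CorrelationGraph m}
    (σ : SplitSeq G H) : List ℕ :=
  σ.length :: σ.encodeSteps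

/-! ### Random access machines

The only arithmetic is addition and truncated subtraction, so after `t` steps every stored number
has `O(t)` bits more than the constants and the input; this is the usual RAM whose polynomial time
agrees with that of Turing machines. -/

/-- The memory: `mem b i` is the number in cell `i` of bank `b`. A program mentions only finitely
many banks. -/
abbrev Mem : Type := ℕ → ℕ → ℕ

/-- Expressions: constants, memory access with a computed index, addition, truncated
subtraction. -/
inductive Expr : Type
  | lit (c : ℕ)
  | read (b : ℕ) (i : Expr)
  | add (x y : Expr)
  | sub (x y : Expr)

def Expr.eval (s : Mem) : Expr → ℕ
  | .lit c => c
  | .read b i => s b (i.eval s)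
  | .add x y => x.eval s + y.eval s
  | .sub x y => x.eval s - y.eval s

/-- The number of elementary operations in the evaluation of an expression. -/
def Expr.cost : Expr → ℕ
  | .lit _ => 1
  | .read _ i => i.cost + 1
  | .add x y => x.cost + y.cost + 1
  | .sub x y => x.cost + y.cost + 1

/-- Programs; `write b i e` stores the value of `e` in cell `i` of bank `b`, tests ask whether an
expression is nonzero. -/
inductive Program : Type
  | skip
  | write (b : ℕ) (i e : Expr)
  | seq (c d : Program)
  | ite (e : Expr) (c d : Program)
  | loop (e : Expr) (c : Program)

/-- The memory `s` with `x` stored in cell `i` of bank `b`. -/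
def Mem.set (s : Mem) (b i x : ℕ) : Mem :=
  Function.update s b (Function.update (s b) i x)

/-- `Run c s t s'`: the program `c`, started with memory `s`, halts after exactly `t` steps with
memory `s'`. -/
inductive Run : Program → Mem → ℕ → Mem → Prop
  | skip (s : Mem) : Run .skip s 1 s
  | write (b : ℕ) (i e : Expr) (s : Mem) :
      Run (.write b i e) s (i.cost + e.cost + 1) (s.set b (i.eval s) (e.eval s))
  | seq {c d : Program} {s s' s'' : Mem} {t t' : ℕ} :
      Run c s t s' → Run d s' t' s'' → Run (.seq c d) s (t + t') s''
  | ite_true {e : Expr} {c d : Program} {s s' : Mem} {t : ℕ} :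
      e.eval s ≠ 0 → Run c s t s' → Run (.ite e c d) s (e.cost + 1 + t) s'
  | ite_false {e : Expr} {c d : Program} {s s' : Mem} {t : ℕ} :
      e.eval s = 0 → Run d s t s' → Run (.ite e c d) s (e.cost + 1 + t) s'
  | loop_done {e : Expr} {c : Program} {s : Mem} :
      e.eval s = 0 → Run (.loop e c) s (e.cost + 1) s
  | loop_step {e : Expr} {c : Program} {s s' s'' : Mem} {t t' : ℕ} :
      e.eval s ≠ 0 → Run c s t s' → Run (.loop e c) s' t' s'' →
        Run (.loop e c) s (e.cost + 1 + t + t') s''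

/-- The initial memory: the input word in bank `0`, and zeros everywhere else. -/
def Mem.init (w : List ℕ) : Mem :=
  fun b i => if b = 0 then w.getD i 0 else 0

/-- The output bank `1` starts with the word `w`. -/
def Mem.Outputs (s : Mem) (w : List ℕ) : Prop :=
  ∀ (i : ℕ) (hi : i < w.length), s 1 i = w[i]

end PVS

namespace PVS

/-! Call a triangle with two blue edges and one red edge bad. A maximal family of disjoint bad
triangles has a vertex set A, whose members are called marked. Outside A blue adjacency is
transitive, so the unmarked vertices fall into blue cliques. Form the bipartite graph that joins an
unmarked vertex a to the pair (v, c) whenever the marked vertex v is a blue neighbour of a and c is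
the clique of a. A vertex cover of it, made of vertices T and pairs Q, yields a solution: every
vertex of A ∪ T receives a copy in its own cluster, and v receives a copy in c for every (v, c) in
Q. The originals of A ∪ T end up as one blue clique that is red to everything else. It preserves
their mutual blue edges, while their mutual red edges survive between originals and copies. This
takes at most |A| + |T| + |Q| splits (`SplitPlan`, `PairData`), and a cover with |T| + |Q| ≤ |M| is
found, where M is the set of unmarked vertices matched by some matching. For the lower bound
(`lower_bound`), let x be the total number of copies of vertices of A in a clustered graph and y the
number of split vertices in M. The split vertices hit every bad triangle, so |A| ≤ 3(x - |A|). An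
unsplit vertex of M has a blue edge to a copy of its mate, and no copy serves two of them, as these
would be joined by a red edge; thus |M| ≤ y + x. Since opt ≥ (x - |A|) + y, this gives |A| + |M| ≤
2|A| + (x - |A|) + y ≤ 7 opt. Matching and cover come from an auction with integer prices
(`AuctionInv`). An unmatched vertex bids on its cheapest pair, expels the owner and raises the price
by one, as long as that price is below N = (n + 2)². At the end some g with 1 ≤ g < N is not a
price. Vertices with a neighbouring pair cheaper than g, together with the pairs dearer than g, form
the cover: each such vertex is matched, each such pair is owned, and its owner is not among these
vertices because owners overpay by at most one (`AuctionInv.card_cover_le`). The machine program is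
written with counted loops only, so its polynomial running time is read off its syntax
(`Cmd.exists_run`). Banks: 0 input, 1 output, 2 multiples of n, 3 marks, 4 clusters, 5 price limit,
6 prices, 7 mates plus one, 8 and 9 current best offer, 10 split vertices, 11 the gap g, 12 chosen
pairs, 13 output position, 14 to 16 scratch, from 20 on loop counters. -/

/-! ### Lower bound for every clustering sequence -/

/-- Sending each final vertex to the vertex it descends from reduces a sequence of splits to its end
result: the fibres are the sets of copies, and each coloured edge survives between some two copies
of its ends. -/
theorem SplitSeq.exists_projection {n m : ℕ} {G : CorrelationGraph n} {H : CorrelationGraph m}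
    (τ : SplitSeq G H) : m = n + τ.length ∧ ∃ φ : Fin m → Fin n, Function.Surjective φ ∧
      (∀ a b, G.blue.Adj a b → ∃ a' b', φ a' = a ∧ φ b' = b ∧ H.blue.Adj a' b') ∧
      (∀ a b, G.red.Adj a b → ∃ a' b', φ a' = a ∧ φ b' = b ∧ H.red.Adj a' b') := by
  induction τ with
  | nil G =>
    exact ⟨rfl, id, Function.surjective_id, fun a b h => ⟨a, b, rfl, rfl, h⟩,
      fun a b h => ⟨a, b, rfl, rfl, h⟩⟩
  | @cons n m G H v G' h σ ih =>
    obtain ⟨hm, φ, hs, hb, hr⟩ := ih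
    refine ⟨by simp only [SplitSeq.length]; omega, fun w => Fin.lastCases v id (φ w), ?_, ?_, ?_⟩
    · intro a
      obtain ⟨w, hw⟩ := hs a.castSucc
      exact ⟨w, by simp [hw]⟩
    · have key : ∀ a b, G.blue.Adj a b → ∃ a' b', G'.blue.Adj a' b' ∧
          Fin.lastCases (motive := fun _ => Fin n) v id a' = a ∧
          Fin.lastCases (motive := fun _ => Fin n) v id b' = b := by
        intro a b hab
        by_cases ha : a = v
        · subst ha
          rcases h.blue_kept b hab with h1 | h1
          · exact ⟨_, _, h1, by simp, by simp⟩
          · exact ⟨_, _, h1, by simp, by simp⟩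
        · by_cases hb' : b = v
          · subst hb'
            rcases h.blue_kept a hab.symm with h1 | h1
            · exact ⟨_, _, h1.symm, by simp, by simp⟩
            · exact ⟨_, _, h1.symm, by simp, by simp⟩
          · exact ⟨_, _, (h.blue_unchanged a b ha hb').2 hab, by simp, by simp⟩
      intro a b hab
      obtain ⟨a', b', h1, h2, h3⟩ := key a b hab
      obtain ⟨a'', b'', h4, h5, h6⟩ := hb a' b' h1
      exact ⟨a'', b'', by simp [h4, h2], by simp [h5, h3], h6⟩
    · have key : ∀ a b, G.red.Adj a b → ∃ a' b', G'.red.Adj a' b' ∧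
          Fin.lastCases (motive := fun _ => Fin n) v id a' = a ∧
          Fin.lastCases (motive := fun _ => Fin n) v id b' = b := by
        intro a b hab
        by_cases ha : a = v
        · subst ha
          rcases h.red_kept b hab with h1 | h1
          · exact ⟨_, _, h1, by simp, by simp⟩
          · exact ⟨_, _, h1, by simp, by simp⟩
        · by_cases hb' : b = v
          · subst hb'
            rcases h.red_kept a hab.symm with h1 | h1
            · exact ⟨_, _, h1.symm, by simp, by simp⟩
            · exact ⟨_, _, h1.symm, by simp, by simp⟩
          · exact ⟨_, _, (h.red_unchanged a b ha hb').2 hab, by simp, by simp⟩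
      intro a b hab
      obtain ⟨a', b', h1, h2, h3⟩ := key a b hab
      obtain ⟨a'', b'', h4, h5, h6⟩ := hr a' b' h1
      exact ⟨a'', b'', by simp [h4, h2], by simp [h5, h3], h6⟩

/-- A red edge inside a blue component closes a blue path to an erroneous cycle. Disjointness of the
colours ensures that the red edge is not on the path and is the only red edge of the cycle. -/
theorem CorrelationGraph.not_red_of_reachable {m : ℕ} {H : CorrelationGraph m}
    (hH : ¬ H.HasErroneousCycle) {x y : Fin m} (hxy : H.blue.Reachable x y) :
    ¬ H.red.Adj x y := by
  classical
  intro hr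
  obtain ⟨p⟩ := hxy.symm
  have hle : H.blue ≤ H.blue ⊔ H.red := le_sup_left
  let q : H.blue.Path y x := p.toPath
  have hq : ∀ e ∈ (q.1.mapLe hle).edges, e ∈ H.blue.edgeSet := by
    intro e he
    rw [SimpleGraph.Walk.edges_mapLe_eq_edges] at he
    exact q.1.edges_subset_edgeSet he
  have hd : ∀ e ∈ H.blue.edgeSet, e ∉ H.red.edgeSet := by
    intro e
    induction e with
    | _ a b =>
      intro h1 h2
      exact (SimpleGraph.disjoint_left.1 H.disjoint a b) h1 h2
  have hne : s(x, y) ∉ (q.1.mapLe hle).edges := fun h => hd _ (hq _ h) hr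
  have hp : (q.1.mapLe hle).IsPath := (SimpleGraph.Walk.isPath_mapLe hle).2 q.2
  refine hH ⟨x, SimpleGraph.Walk.cons (Or.inr hr) (q.1.mapLe hle), ?_, s(x, y), ?_, ?_⟩
  · exact SimpleGraph.Path.cons_isCycle ⟨_, hp⟩ (Or.inr hr) hne
  · exact ⟨by simp, hr⟩
  · rintro e ⟨he, her⟩
    rw [SimpleGraph.Walk.edges_cons, List.mem_cons] at he
    rcases he with he | he
    · exact he
    · exact absurd her (hd _ (hq _ he))

/-- Blue adjacency, as a relation between numbers. -/
def CorrelationGraph.bl {n : ℕ} (G : CorrelationGraph n) (a b : ℕ) : Prop :=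
  ∃ (ha : a < n) (hb : b < n), G.blue.Adj ⟨a, ha⟩ ⟨b, hb⟩

theorem CorrelationGraph.bl_symm {n : ℕ} {G : CorrelationGraph n} {a b : ℕ} (h : G.bl a b) :
    G.bl b a := by
  obtain ⟨ha, hb, h⟩ := h
  exact ⟨hb, ha, h.symm⟩

theorem CorrelationGraph.bl_irrefl {n : ℕ} {G : CorrelationGraph n} {a : ℕ} : ¬ G.bl a a := by
  rintro ⟨ha, hb, h⟩
  exact G.blue.irrefl h

theorem CorrelationGraph.red_iff {n : ℕ} {G : CorrelationGraph n} (hG : G.IsComplete)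
    (a b : Fin n) : G.red.Adj a b ↔ a ≠ b ∧ ¬ G.blue.Adj a b := by
  constructor
  · intro h
    exact ⟨h.ne, fun hb => SimpleGraph.disjoint_left.1 G.disjoint a b hb h⟩
  · rintro ⟨h1, h2⟩
    have : (G.blue ⊔ G.red).Adj a b := by rw [hG]; exact h1
    exact this.resolve_left h2

/-- A bad triangle: two blue edges and one red edge. -/
def CorrelationGraph.Bad {n : ℕ} (G : CorrelationGraph n) (a b c : ℕ) : Prop :=
  G.bl a b ∧ G.bl b c ∧ a ≠ c ∧ ¬ G.bl a c

/-- Here A stands for the packed triangles and M for the matched vertices. `hhit` is all that is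
used of the packing: a set that hits every bad triangle contains at least a third of A. `hinj` says
that vertices with a common mate lie in different clusters. -/
theorem lower_bound {n m : ℕ} {G : CorrelationGraph n} (hG : G.IsComplete)
    {H : CorrelationGraph m} (τ : SplitSeq G H) (hτ : τ.Clusters)
    (A M : Finset ℕ) (hA : A ⊆ Finset.range n) (hM : M ⊆ Finset.range n) (hAM : Disjoint A M)
    (hhit : ∀ W : Finset ℕ, (∀ a b c, G.Bad a b c → a ∈ W ∨ b ∈ W ∨ c ∈ W) →
      A.card ≤ 3 * (A ∩ W).card)
    (mate : ℕ → ℕ) (hmate : ∀ a ∈ M, mate a ∈ A ∧ G.bl (mate a) a)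
    (hinj : ∀ a ∈ M, ∀ b ∈ M, mate a = mate b → ¬ G.bl a b) :
    A.card + M.card ≤ 7 * τ.length := by
  classical
  obtain ⟨hm, φ, hs, hb, hr⟩ := τ.exists_projection
  have hH : ¬ H.HasErroneousCycle := hτ
  let F : ℕ → Finset (Fin m) := fun a => Finset.univ.filter fun w => (φ w : ℕ) = a
  let k : ℕ → ℕ := fun a => (F a).card
  have hmF : ∀ w a, w ∈ F a ↔ (φ w : ℕ) = a := fun w a => by simp [F]
  have hk1 : ∀ a ∈ Finset.range n, 1 ≤ k a := by
    intro a ha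
    obtain ⟨w, hw⟩ := hs ⟨a, Finset.mem_range.1 ha⟩
    exact Finset.card_pos.2 ⟨w, by simp [F, hw]⟩
  have hsum : n + τ.length = ∑ a ∈ Finset.range n, k a := by
    have := Finset.card_eq_sum_card_fiberwise (s := (Finset.univ : Finset (Fin m)))
      (t := Finset.range n) (f := fun w => (φ w : ℕ)) (fun w _ => by simp)
    simpa [← hm] using this
  let W : Finset ℕ := (Finset.range n).filter fun a => 2 ≤ k a
  have huniq : ∀ a, a < n → a ∉ W → ∀ w ∈ F a, ∀ w' ∈ F a, w = w' := by
    intro a ha haW w hw w' hw'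
    have : k a ≤ 1 := by
      by_contra h
      exact haW (by simp [W, ha]; omega)
    exact Finset.card_le_one.1 this w hw w' hw'
  have hlift : ∀ a b, G.bl a b → ∃ a' ∈ F a, ∃ b' ∈ F b, H.blue.Adj a' b' := by
    rintro a b ⟨ha, hb', h⟩
    obtain ⟨a', b', h1, h2, h3⟩ := hb _ _ h
    exact ⟨a', by simp [F, h1], b', by simp [F, h2], h3⟩
  have hliftr : ∀ a b, a < n → b < n → a ≠ b → ¬ G.bl a b →
      ∃ a' ∈ F a, ∃ b' ∈ F b, H.red.Adj a' b' := by
    intro a b ha hb' hab h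
    obtain ⟨a', b', h1, h2, h3⟩ := hr ⟨a, ha⟩ ⟨b, hb'⟩ ((CorrelationGraph.red_iff hG _ _).2
      ⟨by simpa using hab, fun h' => h ⟨ha, hb', h'⟩⟩)
    exact ⟨a', by simp [F, h1], b', by simp [F, h2], h3⟩
  -- If no vertex of a bad triangle is split, the three edges lift to the unique copies, giving a
  -- red edge between the ends of a blue path.
  have hW : ∀ a b c, G.Bad a b c → a ∈ W ∨ b ∈ W ∨ c ∈ W := by
    rintro a b c ⟨hab, hbc, hne, hac⟩
    by_contra! hcon
    obtain ⟨h1, h2, h3⟩ := hcon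
    have ha := hab.1
    have hb' := hbc.1
    have hc := hbc.2.1
    obtain ⟨x, hx, y, hy, hxy⟩ := hlift _ _ hab
    obtain ⟨y', hy', z, hz, hyz⟩ := hlift _ _ hbc
    obtain ⟨x', hx', z', hz', hxz⟩ := hliftr _ _ ha hc hne hac
    rw [huniq a ha h1 _ hx' _ hx, huniq c hc h3 _ hz' _ hz] at hxz
    rw [huniq b hb' h2 _ hy' _ hy] at hyz
    exact CorrelationGraph.not_red_of_reachable hH (hxy.reachable.trans hyz.reachable) hxz
  have h1 := hhit W hW
  have hM2 : M.card ≤ (M ∩ W).card + ∑ a ∈ A, k a := by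
    have hsplit : M.card = (M ∩ W).card + (M \ W).card := by
      rw [add_comm, Finset.card_sdiff_add_card_inter]
    have hfib : ∑ a ∈ A, k a = (Finset.univ.filter fun w : Fin m => (φ w : ℕ) ∈ A).card := by
      rw [Finset.card_eq_sum_card_fiberwise (t := A) (f := fun w => (φ w : ℕ))
        (fun w hw => by simpa using hw)]
      refine Finset.sum_congr rfl fun a ha => congrArg Finset.card ?_
      ext w
      simp only [F, Finset.mem_filter, Finset.mem_univ, true_and]
      exact ⟨fun h => ⟨h ▸ ha, h⟩, fun h => h.2⟩
    rw [hsplit, hfib]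
    -- Each unsplit vertex of M is charged to a copy `w` of its mate to which it has a blue edge.
    -- Two vertices charged to the same `w` would be blue-connected in `H`, yet the red edge between
    -- them survives between their only copies.
    refine Nat.add_le_add_left (Finset.card_le_card_of_forall_subsingleton
      (fun a w => (φ w : ℕ) = mate a ∧ ∃ a' ∈ F a, H.blue.Adj w a') ?_ ?_) _
    · intro a ha
      have ha' := hmate a (Finset.mem_sdiff.1 ha).1
      obtain ⟨w, hw, a', h5, h6⟩ := hlift _ _ ha'.2
      rw [hmF] at hw
      exact ⟨w, by simpa [hw] using ha'.1, hw, a', h5, h6⟩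
    · rintro w - a ⟨ha, hwa, a', ha', hadj⟩ b ⟨hb, hwb, b', hb', hadj'⟩
      obtain ⟨haM, haW⟩ := Finset.mem_sdiff.1 ha
      obtain ⟨hbM, hbW⟩ := Finset.mem_sdiff.1 hb
      by_contra hne
      have hbl := hinj a haM b hbM (hwa.symm.trans hwb)
      have han := Finset.mem_range.1 (hM haM)
      have hbn := Finset.mem_range.1 (hM hbM)
      obtain ⟨x, hx, y, hy, hxy⟩ := hliftr a b han hbn hne hbl
      rw [huniq a han haW _ hx _ ha', huniq b hbn hbW _ hy _ hb'] at hxy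
      exact CorrelationGraph.not_red_of_reachable hH
        (hadj.symm.reachable.trans hadj'.reachable) hxy
  have hsumA : ∑ a ∈ Finset.range n, k a = ∑ a ∈ Finset.range n \ A, k a + ∑ a ∈ A, k a :=
    (Finset.sum_sdiff hA).symm
  have h2 : A.card + (A ∩ W).card ≤ ∑ a ∈ A, k a := by
    have : A.card + (A ∩ W).card = ∑ a ∈ A, (1 + if a ∈ W then 1 else 0) := by
      rw [Finset.sum_add_distrib, Finset.sum_boole, ← Finset.filter_mem_eq_inter]
      simp
    rw [this]
    refine Finset.sum_le_sum fun a ha => ?_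
    split_ifs with h
    · exact (Finset.mem_filter.1 h).2
    · exact hk1 a (hA ha)
  have h3 : (n - A.card) + (M ∩ W).card ≤ ∑ a ∈ Finset.range n \ A, k a := by
    have hc : (Finset.range n \ A).card = n - A.card := by
      rw [Finset.card_sdiff_of_subset hA, Finset.card_range]
    have hsub : M ∩ W ⊆ (Finset.range n \ A) ∩ W := by
      intro a ha
      obtain ⟨h4, h5⟩ := Finset.mem_inter.1 ha
      exact Finset.mem_inter.2 ⟨Finset.mem_sdiff.2 ⟨hM h4,
        fun h6 => Finset.disjoint_left.1 hAM h6 h4⟩, h5⟩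
    have h7 := Finset.card_le_card hsub
    have : (Finset.range n \ A).card + ((Finset.range n \ A) ∩ W).card =
        ∑ a ∈ Finset.range n \ A, (1 + if a ∈ W then 1 else 0) := by
      rw [Finset.sum_add_distrib, Finset.sum_boole, ← Finset.filter_mem_eq_inter]
      simp
    have h8 : ∑ a ∈ Finset.range n \ A, (1 + if a ∈ W then 1 else 0) ≤
        ∑ a ∈ Finset.range n \ A, k a := by
      refine Finset.sum_le_sum fun a ha => ?_
      split_ifs with h
      · exact (Finset.mem_filter.1 h).2
      · exact hk1 a (Finset.mem_sdiff.1 ha).1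
    omega
  have h4 : A.card ≤ n := by simpa using Finset.card_le_card hA
  omega

/-! ### From a list of pairs (vertex, cluster) to a clustering sequence -/

/-- A list of splits `(v k, c k)`, `k < len`: the `k`-th split creates a copy of `v k` in the
cluster labelled `c k`; the vertices in `S` are those that are split. -/
structure SplitPlan {n : ℕ} (G : CorrelationGraph n) where
  S : ℕ → Prop
  rep : ℕ → ℕ
  v : ℕ → ℕ
  c : ℕ → ℕ
  len : ℕ
  v_lt : ∀ k < len, v k < n
  v_mem : ∀ k < len, S (v k)
  mem_v : ∀ s < n, S s → ∃ k < len, v k = s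
  rep_iff : ∀ a < n, ∀ b < n, ¬ S a → ¬ S b → a ≠ b → (G.bl a b ↔ rep a = rep b)
  cover : ∀ s u, S s → ¬ S u → G.bl s u → ∃ k < len, v k = s ∧ c k = rep u

namespace SplitPlan

variable {n : ℕ} {G : CorrelationGraph n} (D : SplitPlan G)

/-- These two predicates record how far the edges at the original of a split vertex have changed.
Once either end of a pair in `S` has been split, the originals are blue to each other for good. A
blue edge to an unsplit vertex of cluster `x` turns red at the original when the copy for `x`
appears and takes it over. -/
def Processed (k i : ℕ) : Prop := ∃ l < k, D.v l = i

def Moved (k i x : ℕ) : Prop := ∃ l < k, D.v l = i ∧ D.c l = x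

open Classical in
/-- Blue adjacency of distinct vertices after `k` splits. -/
def Blue (k i j : ℕ) : Prop :=
  if i < n then
    if j < n then
      if D.S i then
        if D.S j then G.bl i j ∨ D.Processed k i ∨ D.Processed k j
        else G.bl i j ∧ ¬ D.Moved k i (D.rep j)
      else
        if D.S j then G.bl i j ∧ ¬ D.Moved k j (D.rep i)
        else G.bl i j
    else ¬ D.S i ∧ D.rep i = D.c (j - n)
  else
    if j < n then ¬ D.S j ∧ D.rep j = D.c (i - n)
    else D.c (i - n) = D.c (j - n)

theorem blue_symm {k i j : ℕ} (h : D.Blue k i j) : D.Blue k j i := by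
  have := fun h' : G.bl i j => CorrelationGraph.bl_symm h'
  unfold Blue at h ⊢
  split_ifs at h ⊢ <;> tauto

/-- The graph after `k` splits. -/
def stage (k : ℕ) : CorrelationGraph (n + k) where
  blue := { Adj := fun i j => i ≠ j ∧ D.Blue k i j
            symm := ⟨fun _ _ h => ⟨h.1.symm, D.blue_symm h.2⟩⟩
            loopless := ⟨fun _ h => h.1 rfl⟩ }
  red := { Adj := fun i j => i ≠ j ∧ ¬ D.Blue k i j
           symm := ⟨fun _ _ h => ⟨h.1.symm, fun h' => h.2 (D.blue_symm h')⟩⟩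
           loopless := ⟨fun _ h => h.1 rfl⟩ }
  disjoint := by
    rw [SimpleGraph.disjoint_left]
    exact fun _ _ h h' => h'.2 h.2

theorem stage_isComplete (k : ℕ) : (D.stage k).IsComplete := by
  ext i j
  simp only [stage, SimpleGraph.sup_adj, SimpleGraph.top_adj]
  tauto

theorem stage_zero (hG : G.IsComplete) : D.stage 0 = G := by
  have h1 : ∀ a b : Fin n, D.Blue 0 a b ↔ G.blue.Adj a b := by
    intro a b
    have : G.bl a b ↔ G.blue.Adj a b := ⟨fun ⟨_, _, h⟩ => h, fun h => ⟨a.2, b.2, h⟩⟩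
    rw [← this]
    simp [Blue, Processed, Moved]
  have hb : (D.stage 0).blue = G.blue := by
    ext a b
    exact ⟨fun h => (h1 a b).1 h.2, fun h => ⟨h.ne, (h1 a b).2 h⟩⟩
  have hr : (D.stage 0).red = G.red := by
    ext a b
    rw [CorrelationGraph.red_iff hG, ← h1 a b]
    exact Iff.rfl
  cases G
  simp only [stage] at hb hr ⊢
  simp only [CorrelationGraph.mk.injEq]
  exact ⟨hb, hr⟩

theorem processed_succ {k i : ℕ} : D.Processed (k + 1) i ↔ D.Processed k i ∨ D.v k = i := by
  constructor
  · rintro ⟨l, hl, h⟩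
    rcases Nat.lt_succ_iff_lt_or_eq.1 hl with h' | rfl
    · exact Or.inl ⟨l, h', h⟩
    · exact Or.inr h
  · rintro (⟨l, hl, h⟩ | h)
    · exact ⟨l, by omega, h⟩
    · exact ⟨k, by omega, h⟩

theorem moved_succ {k i x : ℕ} :
    D.Moved (k + 1) i x ↔ D.Moved k i x ∨ (D.v k = i ∧ D.c k = x) := by
  constructor
  · rintro ⟨l, hl, h⟩
    rcases Nat.lt_succ_iff_lt_or_eq.1 hl with h' | rfl
    · exact Or.inl ⟨l, h', h⟩
    · exact Or.inr h
  · rintro (⟨l, hl, h⟩ | h)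
    · exact ⟨l, by omega, h⟩
    · exact ⟨k, by omega, h⟩

theorem blue_succ_of_ne {k i j : ℕ} (hi : i ≠ D.v k) (hj : j ≠ D.v k) :
    D.Blue (k + 1) i j ↔ D.Blue k i j := by
  have hi' : D.v k ≠ i := hi.symm
  have hj' : D.v k ≠ j := hj.symm
  simp [Blue, processed_succ, moved_succ, hi', hj']

/-- Only edges at `v k` change. A blue edge to another original in `S` stays at the old vertex, and
a blue edge to an unsplit vertex stays there too unless the new copy joins that very cluster. A red
edge to an original in `S` passes to the new copy, which is red to all these originals; every other
red edge stays. -/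
theorem stage_isSplit {k : ℕ} (hk : k < D.len) :
    IsSplit (D.stage k) ⟨D.v k, (D.v_lt k hk).trans_le (Nat.le_add_right n k)⟩
      (D.stage (k + 1)) := by
  have hv := D.v_lt k hk
  have hS := D.v_mem k hk
  constructor
  · intro a b ha hb
    have ha' : (a : ℕ) ≠ D.v k := fun h => ha (Fin.ext h)
    have hb' : (b : ℕ) ≠ D.v k := fun h => hb (Fin.ext h)
    change (_ ∧ D.Blue (k + 1) a b) ↔ (_ ∧ D.Blue k a b)
    rw [D.blue_succ_of_ne ha' hb']
    simp
  · intro a b ha hb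
    have ha' : (a : ℕ) ≠ D.v k := fun h => ha (Fin.ext h)
    have hb' : (b : ℕ) ≠ D.v k := fun h => hb (Fin.ext h)
    change (_ ∧ ¬ D.Blue (k + 1) a b) ↔ (_ ∧ ¬ D.Blue k a b)
    rw [D.blue_succ_of_ne ha' hb']
    simp
  · rintro a ⟨hne, h⟩
    have hva : D.v k ≠ a := fun h' => hne (Fin.ext h')
    have han : n + k ≠ a := by omega
    suffices h2 : D.Blue (k + 1) (D.v k) a ∨ D.Blue (k + 1) (n + k) a by
      refine h2.imp (fun h3 => ⟨?_, h3⟩) (fun h3 => ⟨?_, h3⟩)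
      · exact fun h4 => hva (congrArg Fin.val h4)
      · exact fun h4 => han (congrArg Fin.val h4)
    change D.Blue k (D.v k) a at h
    simp only [Blue, hv, hS, if_true, not_true, false_and] at h ⊢
    simp only [processed_succ, moved_succ, Nat.not_lt.2 (Nat.le_add_right n k), if_false,
      Nat.add_sub_cancel_left]
    split_ifs at h ⊢ <;> tauto
  · rintro a ⟨hne, h⟩
    have hva : D.v k ≠ a := fun h' => hne (Fin.ext h')
    have han : n + k ≠ a := by omega
    suffices h2 : ¬ D.Blue (k + 1) (D.v k) a ∨ ¬ D.Blue (k + 1) (n + k) a by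
      refine h2.imp (fun h3 => ⟨?_, h3⟩) (fun h3 => ⟨?_, h3⟩)
      · exact fun h4 => hva (congrArg Fin.val h4)
      · exact fun h4 => han (congrArg Fin.val h4)
    change ¬ D.Blue k (D.v k) a at h
    simp only [Blue, hv, hS, if_true, not_true, false_and] at h ⊢
    simp only [processed_succ, moved_succ, Nat.not_lt.2 (Nat.le_add_right n k), if_false,
      Nat.add_sub_cancel_left]
    split_ifs at h ⊢ <;> tauto

open Classical in
/-- The cluster of a vertex of the final graph. -/
noncomputable def label (i : ℕ) : Option ℕ :=
  if i < n then if D.S i then none else some (D.rep i) else some (D.c (i - n))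

/-- At the end every vertex of `S` has been processed (`mem_v`) and every blue edge from `S` to an
unsplit vertex has been moved to a copy (`cover`). Hence the blue graph is a disjoint union of
cliques, with the originals of `S` forming the clique `none`. -/
theorem blue_len_iff {i j : ℕ} (hij : i ≠ j) : D.Blue D.len i j ↔ D.label i = D.label j := by
  have h1 : ∀ a b, b < n → D.S a → ¬ D.S b → ¬ (G.bl a b ∧ ¬ D.Moved D.len a (D.rep b)) :=
    fun a b hb ha hb' h => h.2 (D.cover a b ha hb' h.1)
  unfold Blue label
  split_ifs with a1 a2 a3 a4 a4 a5 a6 a7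
  · exact iff_of_true (Or.inr (Or.inl (D.mem_v i a1 a3))) rfl
  · simpa using h1 i j a2 a3 a4
  · simpa using fun h => by_contra fun h' => h1 j i a1 a4 a3 ⟨CorrelationGraph.bl_symm h, h'⟩
  · simpa using D.rep_iff i a1 j a2 a3 a4 hij
  all_goals simp_all [eq_comm]

/-- The label is constant along blue edges and changes along red ones, so a trail with exactly one
red edge cannot be closed. -/
theorem label_eq_iff_of_walk {m : ℕ} {H : CorrelationGraph m} {lab : Fin m → Option ℕ}
    (hb : ∀ i j, H.blue.Adj i j → lab i = lab j) (hr : ∀ i j, H.red.Adj i j → lab i ≠ lab j)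
    {u w : Fin m} (p : (H.blue ⊔ H.red).Walk u w) (hp : p.IsTrail) :
    ((∀ e ∈ p.edges, e ∉ H.red.edgeSet) → lab u = lab w) ∧
      ((∃! e, e ∈ p.edges ∧ e ∈ H.red.edgeSet) → lab u ≠ lab w) := by
  induction p with
  | nil => simp
  | @cons u x w h p ih =>
    rw [SimpleGraph.Walk.isTrail_cons] at hp
    obtain ⟨ih1, ih2⟩ := ih hp.1
    simp only [SimpleGraph.Walk.edges_cons, List.mem_cons]
    constructor
    · intro hall
      have h1 : ¬ H.red.Adj u x := hall s(u, x) (Or.inl rfl)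
      exact (hb u x (h.resolve_right h1)).trans (ih1 fun e he => hall e (Or.inr he))
    · rintro ⟨e, ⟨he1, he2⟩, huniq⟩
      by_cases hux : H.red.Adj u x
      · have h2 := huniq s(u, x) ⟨Or.inl rfl, hux⟩
        -- The first edge is the only red one, and a trail does not use it again; so the rest of the
        -- walk is blue and keeps the label.
        rw [← ih1 fun e' he' her => hp.2 (by rw [h2, ← huniq e' ⟨Or.inr he', her⟩]; exact he')]
        exact hr u x hux
      · rw [hb u x (h.resolve_right hux)]
        refine ih2 ⟨e, ⟨he1.resolve_left ?_, he2⟩, fun e' he' => huniq e' ⟨Or.inr he'.1, he'.2⟩⟩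
        rintro rfl
        exact hux he2

theorem stage_len_not_hasErroneousCycle : ¬ (D.stage D.len).HasErroneousCycle := by
  rintro ⟨u, p, hp, huniq⟩
  refine (label_eq_iff_of_walk (lab := fun i => D.label i) ?_ ?_ p hp.isTrail).2 huniq rfl
  · rintro i j ⟨hne, h⟩
    exact (D.blue_len_iff fun h' => hne (Fin.ext h')).1 h
  · rintro i j ⟨hne, h⟩
    exact fun h'' => h ((D.blue_len_iff fun h' => hne (Fin.ext h')).2 h'')

open Classical in
/-- The matrix entry after `k` splits. -/
noncomputable def colour (k i j : ℕ) : ℕ := if i = j then 0 else if D.Blue k i j then 1 else 2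

theorem row_stage (k : ℕ) (a : Fin (n + k)) :
    (D.stage k).row a = (List.range (n + k)).map (D.colour k a) := by
  refine List.ext_getElem (by simp [CorrelationGraph.row]) fun i h1 h2 => ?_
  have hi : i < n + k := by simpa using h2
  simp only [CorrelationGraph.row, List.getElem_ofFn, List.getElem_map, List.getElem_range, colour]
  by_cases h : (a : ℕ) = i
  · subst h
    simp
  · have h' : a ≠ ⟨i, hi⟩ := fun h' => h (congrArg Fin.val h')
    have e1 : (D.stage k).blue.Adj a ⟨i, hi⟩ ↔ D.Blue k a i := and_iff_right h'
    have e2 : (D.stage k).red.Adj a ⟨i, hi⟩ ↔ ¬ D.Blue k a i := and_iff_right h'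
    by_cases hB : D.Blue k a i <;> simp [e1, e2, h, hB]

/-- The encoding of the `k`-th split. -/
noncomputable def stepCode (k : ℕ) : List ℕ :=
  D.v k :: ((List.range (n + k + 1)).map (D.colour (k + 1) (D.v k)) ++
    (List.range (n + k + 1)).map (D.colour (k + 1) (n + k)))

theorem exists_splitSeq_from (r k : ℕ) (hk : k + r = D.len) :
    ∃ σ : SplitSeq (D.stage k) (D.stage D.len), σ.length = r ∧ σ.StaysComplete ∧
      σ.encodeSteps = (List.range' k r).flatMap D.stepCode := by
  induction r generalizing k with
  | zero =>
    obtain rfl : k = D.len := hk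
    exact ⟨.nil _, rfl, trivial, rfl⟩
  | succ r ih =>
    obtain ⟨σ, h1, h2, h3⟩ := ih (k + 1) (by omega)
    refine ⟨.cons _ _ (D.stage_isSplit (by omega)) σ, by simp [SplitSeq.length, h1],
      by rw [SplitSeq.StaysComplete]; exact ⟨D.stage_isComplete _, h2⟩, ?_⟩
    have e1 := D.row_stage (k + 1)
    have e2 := e1 (Fin.castSucc ⟨D.v k, (D.v_lt k (by omega)).trans_le (Nat.le_add_right n k)⟩)
    have e3 := e1 (Fin.last (n + k))
    simp only [SplitSeq.encodeSteps, List.range'_succ, List.flatMap_cons, h3, stepCode]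
    erw [e2, e3]
    simp [add_assoc]

theorem exists_splitSeq (hG : G.IsComplete) :
    ∃ (m : ℕ) (H : CorrelationGraph m) (σ : SplitSeq G H), σ.length = D.len ∧ σ.StaysComplete ∧
      σ.Clusters ∧ σ.encode = D.len :: (List.range D.len).flatMap D.stepCode := by
  have h := D.exists_splitSeq_from D.len 0 (by simp)
  rw [List.range_eq_range']
  obtain ⟨σ, h1, h2, h3⟩ := h
  -- The constructed sequence starts at `D.stage 0`, which equals `G` only propositionally;
  -- generalizing over the starting graph allows the substitution.
  have key : ∀ G' : CorrelationGraph n, G' = G → ∀ σ : SplitSeq G' (D.stage D.len),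
      σ.length = D.len → σ.StaysComplete →
      σ.encodeSteps = (List.range' 0 D.len).flatMap D.stepCode →
      ∃ (m : ℕ) (H : CorrelationGraph m) (σ : SplitSeq G H), σ.length = D.len ∧
        σ.StaysComplete ∧ σ.Clusters ∧
        σ.encode = D.len :: (List.range' 0 D.len).flatMap D.stepCode := by
    rintro G' rfl σ h1 h2 h3
    exact ⟨_, _, σ, h1, h2, D.stage_len_not_hasErroneousCycle, by rw [SplitSeq.encode, h1, h3]⟩
  exact key _ (D.stage_zero hG) σ h1 h2 h3

end SplitPlan

/-! ### Programs with counted loops and their running time -/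

theorem Mem.set_self (s : Mem) (b i x : ℕ) : s.set b i x b = Function.update (s b) i x := by
  simp [Mem.set]

theorem Mem.set_of_ne (s : Mem) {b b' : ℕ} (i x : ℕ) (h : b' ≠ b) : s.set b i x b' = s b' := by
  simp [Mem.set, h]

/-- Programs without unbounded loops; `rep b k c` runs `c` for the values `0, …, n + k - 1` of the
counter in bank `b`, where `n` is the number in cell `0` of bank `0`. -/
inductive Cmd : Type
  | skip
  | write (b : ℕ) (i e : Expr)
  | seq (c d : Cmd)
  | ite (e : Expr) (c d : Cmd)
  | rep (b k : ℕ) (c : Cmd)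

namespace Cmd

/-- The current value of the counter (or variable) in bank `b`. -/
abbrev var (b : ℕ) : Expr := .read b (.lit 0)

abbrev bound (k : ℕ) : Expr := .add (var 0) (.lit k)

def compile : Cmd → Program
  | skip => .skip
  | write b i e => .write b i e
  | seq c d => .seq c.compile d.compile
  | ite e c d => .ite e c.compile d.compile
  | rep b k c => .seq (.write b (.lit 0) (.lit 0)) (.loop (.sub (bound k) (var b))
      (.seq c.compile (.write b (.lit 0) (.add (var b) (.lit 1)))))

/-- The banks a command may write to. -/
def banks : Cmd → List ℕ
  | skip => []
  | write b _ _ => [b]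
  | seq c d => c.banks ++ d.banks
  | ite _ c d => c.banks ++ d.banks
  | rep b _ c => b :: c.banks

/-- The input bank is not written to, and loops do not write to their counters. -/
def Ok : Cmd → Prop
  | skip => True
  | write b _ _ => b ≠ 0
  | seq c d => c.Ok ∧ d.Ok
  | ite _ c d => c.Ok ∧ d.Ok
  | rep b _ c => b ≠ 0 ∧ b ∉ c.banks ∧ c.Ok

instance decidableOk : (c : Cmd) → Decidable c.Ok
  | skip => isTrue trivial
  | write _ _ _ => inferInstanceAs (Decidable (_ ≠ _))
  | seq c d =>
    have := decidableOk c
    have := decidableOk d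
    inferInstanceAs (Decidable (_ ∧ _))
  | ite _ c d =>
    have := decidableOk c
    have := decidableOk d
    inferInstanceAs (Decidable (_ ∧ _))
  | rep _ _ c =>
    have := decidableOk c
    inferInstanceAs (Decidable (_ ∧ _ ∧ _))

/-- The counter is set to `i + 1` outright, whereas the compiled loop increments it. Both agree
because `Ok` forbids the body to write to the counter. -/
def iter (b : ℕ) (f : Mem → Mem) (s : Mem) : ℕ → Mem
  | 0 => s.set b 0 0
  | i + 1 => (f (iter b f s i)).set b 0 (i + 1)

def den : Cmd → Mem → Mem
  | skip, s => s
  | write b i e, s => s.set b (i.eval s) (e.eval s)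
  | seq c d, s => d.den (c.den s)
  | ite e c d, s => if e.eval s ≠ 0 then c.den s else d.den s
  | rep b k c, s => iter b c.den s (s 0 0 + k)

theorem den_frame (c : Cmd) (s : Mem) (b : ℕ) (hb : b ∉ c.banks) : c.den s b = s b := by
  induction c generalizing s with
  | skip => rfl
  | write b' i e => exact Mem.set_of_ne _ _ _ (by simpa [banks] using hb)
  | seq c d ihc ihd =>
    simp only [banks, List.mem_append, not_or] at hb
    rw [den, ihd _ hb.2, ihc _ hb.1]
  | ite e c d ihc ihd =>
    simp only [banks, List.mem_append, not_or] at hb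
    rw [den]
    split_ifs
    · exact ihc _ hb.1
    · exact ihd _ hb.2
  | rep b' k c ih =>
    simp only [banks, List.mem_cons, not_or] at hb
    have : ∀ i, iter b' c.den s i b = s b := by
      intro i
      induction i with
      | zero => exact Mem.set_of_ne _ _ _ hb.1
      | succ i ihi => rw [iter, Mem.set_of_ne _ _ _ hb.1, ih _ hb.2, ihi]
    exact this _

theorem Ok.zero_notMem {c : Cmd} (h : c.Ok) : 0 ∉ c.banks := by
  induction c with
  | skip => simp [banks]
  | write b i e => simpa [banks] using Ne.symm h
  | seq c d ihc ihd => simpa [banks] using ⟨ihc h.1, ihd h.2⟩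
  | ite e c d ihc ihd => simpa [banks] using ⟨ihc h.1, ihd h.2⟩
  | rep b k c ih => simpa [banks] using ⟨Ne.symm h.1, ih h.2.2⟩

theorem iter_counter (b : ℕ) (f : Mem → Mem) (s : Mem) (i : ℕ) : iter b f s i b 0 = i := by
  cases i <;> simp [iter, Mem.set_self]

/-- The invariant rule for loops. -/
theorem rep_induction {b k : ℕ} {c : Cmd} {s : Mem} (I : ℕ → Mem → Prop)
    (h0 : I 0 (s.set b 0 0))
    (hstep : ∀ i s', i < s 0 0 + k → (∀ b' ∉ (rep b k c).banks, s' b' = s b') → s' b 0 = i →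
      I i s' → I (i + 1) ((c.den s').set b 0 (i + 1))) :
    I (s 0 0 + k) ((rep b k c).den s) := by
  have : ∀ i ≤ s 0 0 + k, I i (iter b c.den s i) := by
    intro i
    induction i with
    | zero => exact fun _ => h0
    | succ i ih =>
      intro hi
      refine hstep i _ hi ?_ (iter_counter _ _ _ _) (ih (by omega))
      intro b' hb'
      simp only [banks, List.mem_cons, not_or] at hb'
      clear ih hi
      induction i with
      | zero => exact Mem.set_of_ne _ _ _ hb'.1
      | succ i ihi => rw [iter, Mem.set_of_ne _ _ _ hb'.1, den_frame _ _ _ hb'.2, ihi]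
  exact this _ le_rfl

open Polynomial in
/-- A bound on the running time. -/
noncomputable def time : Cmd → Polynomial ℕ
  | skip => 1
  | write _ i e => C (i.cost + e.cost + 1)
  | seq c d => c.time + d.time
  | ite e c d => C (e.cost + 1) + c.time + d.time
  | rep _ k c => 20 + (X + C k) * (c.time + 20)

/-- The input bank is never written, so `n` is the same whenever a loop bound is evaluated, and
every loop runs exactly `n + k` times. Hence the polynomial `time`, which charges both branches of a
conditional, is a bound. -/
theorem exists_run (c : Cmd) (hc : c.Ok) (s : Mem) :
    ∃ t, Run c.compile s t (c.den s) ∧ t ≤ c.time.eval (s 0 0) := by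
  induction c generalizing s with
  | skip => exact ⟨_, Run.skip s, by simp [time]⟩
  | write b i e => exact ⟨_, Run.write b i e s, by simp [time]⟩
  | seq c d ihc ihd =>
    obtain ⟨t, h1, h2⟩ := ihc hc.1 s
    obtain ⟨t', h3, h4⟩ := ihd hc.2 (c.den s)
    rw [den_frame _ _ _ hc.1.zero_notMem] at h4
    exact ⟨_, Run.seq h1 h3, by rw [time, Polynomial.eval_add]; omega⟩
  | ite e c d ihc ihd =>
    by_cases he : e.eval s = 0
    · obtain ⟨t, h1, h2⟩ := ihd hc.2 s
      refine ⟨_, by rw [den, if_neg (not_not.2 he)]; exact Run.ite_false he h1, ?_⟩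
      simp only [time, Polynomial.eval_add, Polynomial.eval_C]
      omega
    · obtain ⟨t, h1, h2⟩ := ihc hc.1 s
      refine ⟨_, by rw [den, if_pos he]; exact Run.ite_true he h1, ?_⟩
      simp only [time, Polynomial.eval_add, Polynomial.eval_C]
      omega
  | rep b k c ih =>
    obtain ⟨hb0, hbc, hc⟩ := hc
    have hn : ∀ i, iter b c.den s i 0 0 = s 0 0 := by
      intro i
      induction i with
      | zero => rw [iter, Mem.set_of_ne _ _ _ hb0.symm]
      | succ i ihi => rw [iter, Mem.set_of_ne _ _ _ hb0.symm, den_frame _ _ _ hc.zero_notMem, ihi]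
    -- The induction is on the number `j` of remaining iterations. A loop test costs 8 steps and an
    -- increment 6, so 10 for the last test and 20 per iteration are ample.
    have loop : ∀ j i, i + j = s 0 0 + k → ∃ t,
        Run (.loop (.sub (bound k) (var b))
          (.seq c.compile (.write b (.lit 0) (.add (var b) (.lit 1)))))
          (iter b c.den s i) t (iter b c.den s (s 0 0 + k)) ∧
        t ≤ 10 + j * (c.time.eval (s 0 0) + 20) := by
      intro j
      induction j with
      | zero =>
        rintro i hi
        obtain rfl : i = s 0 0 + k := hi
        refine ⟨_, Run.loop_done ?_, ?_⟩
        · simp [Expr.eval, iter_counter, hn]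
        · simp [Expr.cost]
      | succ j ihj =>
        intro i hi
        obtain ⟨t, h1, h2⟩ := ihj (i + 1) (by omega)
        obtain ⟨t', h3, h4⟩ := ih hc (iter b c.den s i)
        have h5 := Run.write b (.lit 0) (.add (var b) (.lit 1)) (c.den (iter b c.den s i))
        simp only [Expr.eval, den_frame _ _ _ hbc, iter_counter] at h5
        refine ⟨_, Run.loop_step ?_ (Run.seq h3 h5) h1, ?_⟩
        · simp only [Expr.eval, iter_counter, hn]
          omega
        · rw [hn] at h4
          simp only [Expr.cost]
          linarith
    obtain ⟨t, h1, h2⟩ := loop (s 0 0 + k) 0 (by simp)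
    refine ⟨_, Run.seq (Run.write b (.lit 0) (.lit 0) s) h1, ?_⟩
    simp only [time, Polynomial.eval_add, Polynomial.eval_mul, Polynomial.eval_X,
      Polynomial.eval_C, Polynomial.eval_ofNat, Expr.cost]
    linarith

theorem den_seq (c d : Cmd) (s : Mem) : (seq c d).den s = d.den (c.den s) := rfl

theorem den_write (b : ℕ) (i e : Expr) (s : Mem) :
    (write b i e).den s = s.set b (i.eval s) (e.eval s) := rfl

/-- Test whether two numbers are equal. -/
def eqE (x y : Expr) : Expr := .sub (.sub (.lit 1) (.sub x y)) (.sub y x)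

theorem eval_eqE {x y : Expr} {s : Mem} : (eqE x y).eval s ≠ 0 ↔ x.eval s = y.eval s := by
  simp only [eqE, Expr.eval]
  omega

/-- Test whether a number is zero. -/
def notE (x : Expr) : Expr := .sub (.lit 1) x

theorem eval_notE {x : Expr} {s : Mem} : (notE x).eval s ≠ 0 ↔ x.eval s = 0 := by
  simp only [notE, Expr.eval]
  omega

/-- Run `c` if all tests succeed. -/
def whenAll : List Expr → Cmd → Cmd
  | [], c => c
  | e :: es, c => ite e (whenAll es c) skip

def Tests (s : Mem) : List Expr → Prop
  | [] => True
  | e :: es => e.eval s ≠ 0 ∧ Tests s es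

theorem tests_nil {s : Mem} : Tests s [] ↔ True := Iff.of_eq (by rw [Tests])

theorem tests_cons {s : Mem} {e : Expr} {es : List Expr} :
    Tests s (e :: es) ↔ e.eval s ≠ 0 ∧ Tests s es := Iff.of_eq (by rw [Tests])

open Classical in
theorem den_whenAll (es : List Expr) (c : Cmd) (s : Mem) :
    (whenAll es c).den s = if Tests s es then c.den s else s := by
  induction es with
  | nil => rw [whenAll, if_pos (tests_nil.2 trivial)]
  | cons e es ih =>
    rw [whenAll, den]
    split_ifs with h1 h2 h2
    · rw [ih, if_pos (tests_cons.1 h2).2]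
    · rw [ih, if_neg fun h3 => h2 (tests_cons.2 ⟨h1, h3⟩)]
    · exact absurd (tests_cons.1 h2).1 h1
    · rfl

def seqs : List Cmd → Cmd
  | [] => skip
  | [c] => c
  | c :: cs => seq c (seqs cs)

/-- The loop rule for invariants that only count the iterations. -/
theorem rep_count {b k n : ℕ} {c : Cmd} (I : ℕ → Mem → Prop) (d : ℕ)
    (hset : ∀ t s x, I t s → I t (s.set b 0 x)) (h0 : 0 ∉ (rep b k c).banks)
    (hstep : ∀ t s, s 0 0 = n → I t s → I (t + d) (c.den s)) (t : ℕ) (s : Mem) (hs : s 0 0 = n)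
    (h : I t s) : I (t + (n + k) * d) ((rep b k c).den s) := by
  have := rep_induction (b := b) (k := k) (c := c) (s := s) (fun i s' => I (t + i * d) s')
    (by simpa using hset _ _ _ h) (fun i s' _ hf _ hI => by
      have := hset _ _ (i + 1) (hstep _ _ (by rw [hf 0 h0, hs]) hI)
      rwa [add_mul, one_mul, ← add_assoc])
  rwa [hs] at this

/-- The matrix position of a pair. The table of the multiples of `n` is in bank `2`. -/
def ix (x y : Expr) : Expr := .add (.read 2 x) y

/-- The colour of a pair in the input. -/
def adj (x y : Expr) : Expr := eqE (.read 0 (.add (ix x y) (.lit 1))) (.lit 1)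

end Cmd

/-! ### The graph in memory -/

/-- The memory holds the graph and the table of multiples. -/
structure Base {n : ℕ} (G : CorrelationGraph n) (s : Mem) : Prop where
  size : s 0 0 = n
  entry : ∀ a < n, ∀ b < n, (s 0 (a * n + b + 1) = 1 ↔ G.bl a b)
  table : ∀ a < n, s 2 a = a * n

namespace Base

variable {n : ℕ} {G : CorrelationGraph n} {s s' : Mem}

theorem congr (h : Base G s) (h0 : s' 0 = s 0) (h2 : s' 2 = s 2) : Base G s' :=
  ⟨by rw [h0, h.size], by rw [h0]; exact h.entry, by rw [h2]; exact h.table⟩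

theorem eval_adj (h : Base G s) {x y : Expr} (hx : x.eval s < n) (hy : y.eval s < n) :
    (Cmd.adj x y).eval s ≠ 0 ↔ G.bl (x.eval s) (y.eval s) := by
  rw [Cmd.adj, Cmd.eval_eqE, ← h.entry _ hx _ hy]
  simp [Expr.eval, Cmd.ix, h.table _ hx]

theorem eval_ix (h : Base G s) {x y : Expr} (hx : x.eval s < n) :
    (Cmd.ix x y).eval s = x.eval s * n + y.eval s := by
  simp [Expr.eval, Cmd.ix, h.table _ hx]

end Base

/-! ### Auction prices and the matching they maintain -/

theorem index_inj {n v v' c c' : ℕ} (hc : c < n) (hc' : c' < n)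
    (h : v * n + c = v' * n + c') : v = v' ∧ c = c' := by
  have hn : 0 < n := by omega
  have h1 := congrArg (· / n) h
  have h2 := congrArg (· % n) h
  simp only [Nat.mul_add_mod_self_right, Nat.mod_eq_of_lt hc, Nat.mod_eq_of_lt hc'] at h2
  subst h2
  exact ⟨Nat.eq_of_mul_eq_mul_right hn (by omega), rfl⟩

theorem index_lt {n v c : ℕ} (hv : v < n) (hc : c < n) : v * n + c < n * n := by
  nlinarith

/-- The invariant of the auction: `mk` marks the vertices of the triangle packing, `rp` gives
the cluster of an unmarked vertex; `mate a = v + 1` means that `a` has bought the right to its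
cluster at `v`, for the price `p (v * n + rp a) - 1`. -/
structure AuctionInv {n : ℕ} (G : CorrelationGraph n) (mk rp : ℕ → ℕ) (N : ℕ) (p mate : ℕ → ℕ) :
    Prop where
  mate_spec : ∀ a v, mate a = v + 1 → mk a = 0 ∧ mk v ≠ 0 ∧ G.bl v a
  inj : ∀ a b, mate a ≠ 0 → mate a = mate b → rp a = rp b → a = b
  own : ∀ v < n, ∀ c < n, p (v * n + c) ≠ 0 → ∃ a, mate a = v + 1 ∧ rp a = c
  slack : ∀ a v w, mate a = v + 1 → mk w ≠ 0 → G.bl w a →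
    p (v * n + rp a) ≤ p (w * n + rp a) + 1
  le : ∀ q, p q ≤ N

/-- The middle case expels the previous owner of the pair formed by `v` and the cluster of `a`. -/
def bidMate (rp mate : ℕ → ℕ) (a v : ℕ) : ℕ → ℕ := fun b =>
  if b = a then v + 1 else if mate b = v + 1 ∧ rp b = rp a then 0 else mate b

def bidPrice (n : ℕ) (rp p : ℕ → ℕ) (a v : ℕ) : ℕ → ℕ :=
  Function.update p (v * n + rp a) (p (v * n + rp a) + 1)

/-- For the bidder, slack holds because it chose a cheapest pair and raised its price by one. For
the other vertices it persists, since prices only grow and the one raised price belongs to a pair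
whose old owner is expelled. `hN` keeps the prices below the limit. -/
theorem AuctionInv.bid {n : ℕ} {G : CorrelationGraph n} {mk rp : ℕ → ℕ} {N : ℕ}
    {p mate : ℕ → ℕ} (h : AuctionInv G mk rp N p mate) (hrp : ∀ a < n, rp a < n) {a v : ℕ}
    (hma : mk a = 0) (hua : mate a = 0) (hv : mk v ≠ 0) (hbl : G.bl v a)
    (hbest : ∀ w, mk w ≠ 0 → G.bl w a → p (v * n + rp a) ≤ p (w * n + rp a))
    (hN : p (v * n + rp a) < N) :
    AuctionInv G mk rp N (bidPrice n rp p a v) (bidMate rp mate a v) := by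
  have hmono : ∀ q, p q ≤ bidPrice n rp p a v q := by
    intro q
    by_cases hq : q = v * n + rp a
    · subst hq; simp [bidPrice]
    · simp [bidPrice, hq]
  have han := hbl.2.1
  constructor
  · intro b u hb
    unfold bidMate at hb
    split_ifs at hb with h1 h2
    · obtain rfl : v = u := by omega
      exact h1 ▸ ⟨hma, hv, hbl⟩
    · exact h.mate_spec b u hb
  · intro b c hb hbc hr
    have h1 := h.inj b c
    unfold bidMate at hb hbc
    grind
  · intro u hu c hc hp
    by_cases hq : u * n + c = v * n + rp a
    · obtain ⟨rfl, rfl⟩ := index_inj hc (hrp a han) hq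
      exact ⟨a, by simp [bidMate], rfl⟩
    · have hp' : p (u * n + c) ≠ 0 := by simpa [bidPrice, hq] using hp
      obtain ⟨b, hb, rfl⟩ := h.own u hu c hc hp'
      have hba : b ≠ a := by
        rintro rfl
        omega
      have : ¬ (mate b = v + 1 ∧ rp b = rp a) := by
        rintro ⟨h1, h2⟩
        obtain rfl : u = v := by omega
        exact hq (by rw [h2])
      exact ⟨b, by rw [bidMate, if_neg hba, if_neg this, hb], rfl⟩
  · intro b u w hb hw hwb
    unfold bidMate at hb
    have h3 := hmono (w * n + rp b)
    split_ifs at hb with h1 h2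
    · obtain rfl : v = u := by omega
      subst h1
      have := hbest w hw hwb
      have h4 : bidPrice n rp p b v (v * n + rp b) = p (v * n + rp b) + 1 := by simp [bidPrice]
      omega
    · have hq : u * n + rp b ≠ v * n + rp a := by
        intro hq
        obtain ⟨h4, h5⟩ := index_inj (hrp b hwb.2.1) (hrp a han) hq
        exact h2 ⟨by rw [hb, h4], h5⟩
      have := h.slack b u w hb hw hwb
      have h4 : bidPrice n rp p a v (u * n + rp b) = p (u * n + rp b) := by simp [bidPrice, hq]
      omega
  · intro q
    by_cases hq : q = v * n + rp a
    · subst hq; simpa [bidPrice] using hN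
    · simpa [bidPrice, hq] using h.le q

/-- The sum of all prices is the progress measure of the auction: it counts the bids and is bounded
through the price limit. -/
theorem sum_bidPrice {n : ℕ} {rp p : ℕ → ℕ} {a v : ℕ} (hv : v < n) (ha : rp a < n) :
    ∑ q ∈ Finset.range (n * n), bidPrice n rp p a v q =
      ∑ q ∈ Finset.range (n * n), p q + 1 := by
  rw [bidPrice, Finset.sum_update_of_mem (Finset.mem_range.2 (index_lt hv ha)),
    ← Finset.sum_sdiff (Finset.singleton_subset_iff.2 (Finset.mem_range.2 (index_lt hv ha)))
      (f := p)]
  simp only [Finset.sum_singleton]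
  ring

/-- Pigeonhole: there are (n + 2)² - 1 candidates but only n² prices. This dictates the price limit
of the auction. -/
theorem exists_gap {n : ℕ} (p : ℕ → ℕ) :
    ∃ g, 1 ≤ g ∧ g < (n + 2) * (n + 2) ∧ ∀ q < n * n, p q ≠ g := by
  by_contra! h
  have hsub : Finset.Ico 1 ((n + 2) * (n + 2)) ⊆ (Finset.range (n * n)).image p := by
    intro g hg
    obtain ⟨h1, h2⟩ := Finset.mem_Ico.1 hg
    obtain ⟨q, hq, hpq⟩ := h g h1 h2
    exact Finset.mem_image.2 ⟨q, Finset.mem_range.2 hq, hpq⟩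
  have h1 := (Finset.card_le_card hsub).trans Finset.card_image_le
  rw [Nat.card_Ico, Finset.card_range] at h1
  have : (n + 2) * (n + 2) = n * n + 4 * n + 4 := by ring
  omega

/-- No unmatched vertex can afford a bid. -/
def Sated {n : ℕ} (G : CorrelationGraph n) (mk rp : ℕ → ℕ) (N : ℕ) (p mate : ℕ → ℕ) (a : ℕ) :
    Prop :=
  mk a = 0 → mate a = 0 → ∀ v, mk v ≠ 0 → G.bl v a → N ≤ p (v * n + rp a)

/-! ### Multiples of n, the triangle packing, and clusters of unmarked vertices -/

open Cmd

/-- A loop rule for searches: `J` is the invariant, `R` a monotone relation between memories, and `T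
i` is what iteration `i` achieves. `T i` is stable under `R`, so at the end all `T i` hold together.
-/
theorem Cmd.rep_foreach {b k : ℕ} {c : Cmd} {s : Mem} {J : Mem → Prop} {R : Mem → Mem → Prop}
    {T : ℕ → Mem → Prop} (hJ : ∀ s x, J s → J (s.set b 0 x)) (hR : ∀ s s' x, R s s' → R s (s'.set b 0 x))
    (hrefl : ∀ s, R s s) (htrans : ∀ s s' s'', R s s' → R s' s'' → R s s'')
    (hT : ∀ i s s', R s s' → T i s → T i s')
    (hstep : ∀ i s', i < s 0 0 + k → (∀ b' ∉ (rep b k c).banks, s' b' = s b') → s' b 0 = i →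
      J s' → J (c.den s') ∧ R s' (c.den s') ∧ T i (c.den s')) (h : J s) :
    J ((rep b k c).den s) ∧ R s ((rep b k c).den s) ∧
      ∀ i < s 0 0 + k, T i ((rep b k c).den s) := by
  refine rep_induction (fun i s' => J s' ∧ R s s' ∧ ∀ j < i, T j s')
    ⟨hJ _ _ h, hR _ _ _ (hrefl s), by simp⟩ ?_
  rintro i s' hi hf hb ⟨h1, h2, h3⟩
  obtain ⟨h4, h5, h6⟩ := hstep i s' hi hf hb h1
  refine ⟨hJ _ _ h4, hR _ _ _ (htrans _ _ _ h2 h5), fun j hj => ?_⟩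
  refine hT j (c.den s') _ (hR _ _ _ (hrefl _)) ?_
  rcases Nat.lt_succ_iff_lt_or_eq.1 hj with hj | rfl
  · exact hT j s' _ h5 (h3 j hj)
  · exact h6

/-- Computes the table of multiples of `n`. -/
def tableCmd : Cmd :=
  rep 20 0 (write 2 (.add (var 20) (.lit 1)) (.add (.read 2 (var 20)) (var 0)))

theorem tableCmd_spec (s : Mem) (h2 : s 2 0 = 0) :
    ∀ a ≤ s 0 0, tableCmd.den s 2 a = a * s 0 0 := by
  refine rep_induction (b := 20) (k := 0) (s := s)
    (c := write 2 (.add (var 20) (.lit 1)) (.add (.read 2 (var 20)) (var 0)))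
    (fun i s' => ∀ a ≤ i, s' 2 a = a * s 0 0) ?_ ?_
  · simp [Mem.set_of_ne, h2]
  · intro i s' hi hf hb hI a ha
    have h0 : s' 0 = s 0 := hf 0 (by decide)
    simp only [den, Expr.eval, hb, h0]
    rw [Mem.set_of_ne _ _ _ (by decide), Mem.set_self]
    rcases Nat.lt_succ_iff_lt_or_eq.1 (Nat.lt_succ_of_le ha) with h | rfl
    · rw [Function.update_of_ne (by omega), hI a (by omega)]
    · rw [Function.update_self, hI i le_rfl]
      ring

/-- The marked vertices are the union of disjoint bad triangles. -/
def Packed {n : ℕ} (G : CorrelationGraph n) (mk : ℕ → ℕ) : Prop :=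
  ∀ W : Finset ℕ, (∀ a b c, G.Bad a b c → a ∈ W ∨ b ∈ W ∨ c ∈ W) →
    ((Finset.range n).filter (mk · ≠ 0)).card ≤ 3 * ((Finset.range n).filter (mk · ≠ 0) ∩ W).card

/-- A new triangle adds three vertices to the marked set and, being bad, at least one new vertex to
its intersection with any hitting set. -/
theorem Packed.add {n : ℕ} {G : CorrelationGraph n} {mk : ℕ → ℕ} (h : Packed G mk) {a b c : ℕ}
    (hbad : G.Bad a b c) (ha : mk a = 0) (hb : mk b = 0) (hc : mk c = 0) :
    Packed G (Function.update (Function.update (Function.update mk a 1) b 1) c 1) := by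
  intro W hW
  have h1 := h W hW
  have han := hbad.1.1
  have hbn := hbad.1.2.1
  have hcn := hbad.2.1.2.1
  have hab : a ≠ b := by rintro rfl; exact CorrelationGraph.bl_irrefl hbad.1
  have hbc : b ≠ c := by rintro rfl; exact CorrelationGraph.bl_irrefl hbad.2.1
  have hac := hbad.2.2.1
  set A := (Finset.range n).filter (mk · ≠ 0) with hA
  have haA : a ∉ A := by simp [hA, ha]
  have hbA : b ∉ A := by simp [hA, hb]
  have hcA : c ∉ A := by simp [hA, hc]
  have hnew : (Finset.range n).filter
      (Function.update (Function.update (Function.update mk a 1) b 1) c 1 · ≠ 0) =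
      insert a (insert b (insert c A)) := by
    ext x
    simp only [hA, Finset.mem_filter, Finset.mem_range, Finset.mem_insert, Function.update_apply]
    split_ifs <;> simp_all
  rw [hnew, Finset.card_insert_of_notMem (by simp [hab, hac, haA]),
    Finset.card_insert_of_notMem (by simp [hbc, hbA]), Finset.card_insert_of_notMem hcA]
  have h2 : ∃ x ∈ W, x ∉ A ∧ x ∈ insert a (insert b (insert c A)) := by
    rcases hW a b c hbad with h | h | h
    · exact ⟨a, h, haA, by simp⟩
    · exact ⟨b, h, hbA, by simp⟩
    · exact ⟨c, h, hcA, by simp⟩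
  obtain ⟨x, hxW, hxA, hx⟩ := h2
  have h3 : insert x (A ∩ W) ⊆ insert a (insert b (insert c A)) ∩ W := by
    intro y hy
    rcases Finset.mem_insert.1 hy with rfl | hy
    · exact Finset.mem_inter.2 ⟨hx, hxW⟩
    · obtain ⟨h4, h5⟩ := Finset.mem_inter.1 hy
      exact Finset.mem_inter.2 ⟨by simp [h4], h5⟩
  have h4 := Finset.card_le_card h3
  rw [Finset.card_insert_of_notMem (fun h => hxA (Finset.mem_inter.1 h).1)] at h4
  omega

/-- Greedily packs and marks bad triangles. -/
def markCmd : Cmd :=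
  rep 20 0 (rep 21 0 (rep 22 0 (whenAll
    [notE (.read 3 (var 20)), notE (.read 3 (var 21)), notE (.read 3 (var 22)),
      adj (var 20) (var 21), adj (var 21) (var 22), notE (eqE (var 20) (var 22)),
      notE (adj (var 20) (var 22))]
    (seqs [write 3 (var 20) (.lit 1), write 3 (var 21) (.lit 1), write 3 (var 22) (.lit 1)]))))

/-- Marks are never erased. A bad triangle is hit when its triple is examined, being packed at that
moment if it was still unmarked, and so it stays hit. -/
theorem markCmd_spec {n : ℕ} {G : CorrelationGraph n} {s : Mem} (hB : Base G s)
    (h3 : s 3 = fun _ => 0) :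
    Packed G (markCmd.den s 3) ∧ ∀ a b c, G.Bad a b c →
      markCmd.den s 3 a ≠ 0 ∨ markCmd.den s 3 b ≠ 0 ∨ markCmd.den s 3 c ≠ 0 := by
  have key := rep_foreach (b := 20) (k := 0) (s := s) (J := fun s => Packed G (s 3))
    (R := fun s s' => ∀ a, s 3 a ≠ 0 → s' 3 a ≠ 0)
    (T := fun a s => ∀ b < n, ∀ c < n, G.Bad a b c → s 3 a ≠ 0 ∨ s 3 b ≠ 0 ∨ s 3 c ≠ 0)
    (c := rep 21 0 (rep 22 0 (whenAll
    [notE (.read 3 (var 20)), notE (.read 3 (var 21)), notE (.read 3 (var 22)),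
      adj (var 20) (var 21), adj (var 21) (var 22), notE (eqE (var 20) (var 22)),
      notE (adj (var 20) (var 22))]
    (seqs [write 3 (var 20) (.lit 1), write 3 (var 21) (.lit 1), write 3 (var 22) (.lit 1)]))))
    (fun s x h => by rwa [Mem.set_of_ne _ _ _ (by decide)])
    (fun s s' x h => by rwa [Mem.set_of_ne _ _ _ (by decide)])
    (fun s a h => h) (fun s s' s'' h h' a ha => h' a (h a ha))
    (fun a s s' hR hT b hb c hc hbad => (hT b hb c hc hbad).imp (hR _) (Or.imp (hR _) (hR _)))
    ?_ (by rw [h3]; intro W _; simp)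
  · obtain ⟨k1, -, k3⟩ := key
    refine ⟨k1, fun a b c hbad => k3 a ?_ b hbad.1.2.1 c hbad.2.1.2.1 hbad⟩
    rw [hB.size]
    exact hbad.1.1
  intro a s1 ha hf1 h20 hP
  have hB1 := hB.congr (hf1 0 (by decide)) (hf1 2 (by decide))
  rw [hB.size] at ha
  have key := rep_foreach (b := 21) (k := 0) (s := s1) (J := fun s => Packed G (s 3))
    (R := fun s s' => ∀ a, s 3 a ≠ 0 → s' 3 a ≠ 0)
    (T := fun b s => ∀ c < n, G.Bad a b c → s 3 a ≠ 0 ∨ s 3 b ≠ 0 ∨ s 3 c ≠ 0)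
    (c := rep 22 0 (whenAll
    [notE (.read 3 (var 20)), notE (.read 3 (var 21)), notE (.read 3 (var 22)),
      adj (var 20) (var 21), adj (var 21) (var 22), notE (eqE (var 20) (var 22)),
      notE (adj (var 20) (var 22))]
    (seqs [write 3 (var 20) (.lit 1), write 3 (var 21) (.lit 1), write 3 (var 22) (.lit 1)])))
    (fun s x h => by rwa [Mem.set_of_ne _ _ _ (by decide)])
    (fun s s' x h => by rwa [Mem.set_of_ne _ _ _ (by decide)])
    (fun s a h => h) (fun s s' s'' h h' a ha => h' a (h a ha))
    (fun b s s' hR hT c hc hbad => (hT c hc hbad).imp (hR _) (Or.imp (hR _) (hR _)))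
    ?_ hP
  · rw [hB1.size] at key
    exact key
  intro b s2 hb hf2 h21 hP
  have hB2 := hB1.congr (hf2 0 (by decide)) (hf2 2 (by decide))
  rw [hB1.size] at hb
  have key := rep_foreach (b := 22) (k := 0) (s := s2) (J := fun s => Packed G (s 3))
    (R := fun s s' => ∀ a, s 3 a ≠ 0 → s' 3 a ≠ 0)
    (T := fun c s => G.Bad a b c → s 3 a ≠ 0 ∨ s 3 b ≠ 0 ∨ s 3 c ≠ 0)
    (c := whenAll
    [notE (.read 3 (var 20)), notE (.read 3 (var 21)), notE (.read 3 (var 22)),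
      adj (var 20) (var 21), adj (var 21) (var 22), notE (eqE (var 20) (var 22)),
      notE (adj (var 20) (var 22))]
    (seqs [write 3 (var 20) (.lit 1), write 3 (var 21) (.lit 1), write 3 (var 22) (.lit 1)]))
    (fun s x h => by rwa [Mem.set_of_ne _ _ _ (by decide)])
    (fun s s' x h => by rwa [Mem.set_of_ne _ _ _ (by decide)])
    (fun s a h => h) (fun s s' s'' h h' a ha => h' a (h a ha))
    (fun c s s' hR hT hbad => (hT hbad).imp (hR _) (Or.imp (hR _) (hR _)))
    ?_ hP
  · rw [hB2.size] at key
    exact key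
  intro c s3 hc hf3 h22 hP
  have hB3 := hB2.congr (hf3 0 (by decide)) (hf3 2 (by decide))
  rw [hB2.size] at hc
  have e21 : s3 21 0 = b := by rw [hf3 21 (by decide), h21]
  have e20 : s3 20 0 = a := by rw [hf3 20 (by decide), hf2 20 (by decide), h20]
  have v20 : (var 20).eval s3 = a := e20
  have v21 : (var 21).eval s3 = b := e21
  have v22 : (var 22).eval s3 = c := h22
  have a1 := hB3.eval_adj (x := var 20) (y := var 21) (by omega) (by omega)
  have a2 := hB3.eval_adj (x := var 21) (y := var 22) (by omega) (by omega)
  have a3 := hB3.eval_adj (x := var 20) (y := var 22) (by omega) (by omega)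
  have a4 := not_congr a3
  have a5 := not_congr (eval_eqE (x := var 20) (y := var 22) (s := s3))
  rw [not_not] at a4 a5
  rw [den_whenAll]
  split_ifs with hcond <;> simp only [tests_cons, tests_nil, and_true, eval_notE, a1, a2, a4, a5,
    Expr.eval, e20, e21, h22] at hcond
  · obtain ⟨m1, m2, m3, b1, b2, hne, b3⟩ := hcond
    simp only [seqs, den, Mem.set_self, Expr.eval,
      Mem.set_of_ne _ _ _ (show 21 ≠ 3 by decide),
      Mem.set_of_ne _ _ _ (show 22 ≠ 3 by decide), e20, e21, h22]
    refine ⟨hP.add ⟨b1, b2, hne, b3⟩ m1 m2 m3, fun x hx => ?_, fun _ => Or.inr (Or.inr (by simp))⟩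
    simp only [Function.update_apply]
    split_ifs <;> simp_all
  · refine ⟨hP, fun _ h => h, fun hbad => ?_⟩
    by_contra! h
    exact hcond ⟨h.1, h.2.1, h.2.2, hbad.1, hbad.2.1, hbad.2.2⟩

/-- Computes the smallest vertex in the cluster of each unmarked vertex. -/
def repCmd : Cmd :=
  rep 20 0 (seqs [write 4 (var 20) (var 20), rep 21 0 (whenAll
    [notE (.read 3 (var 20)), notE (.read 3 (var 21)), adj (var 20) (var 21),
      .sub (.read 4 (var 20)) (var 21)]
    (write 4 (var 20) (var 21)))])

/-- The parameter `i` measures progress: minimality is claimed only against candidates below `i`. A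
marked vertex is its own representative, so its home cluster differs from all cliques of unmarked
vertices. -/
structure RepSpec {n : ℕ} (G : CorrelationGraph n) (mk : ℕ → ℕ) (i v r : ℕ) : Prop where
  le : r ≤ v
  marked : mk v ≠ 0 → r = v
  unmarked : mk v = 0 → mk r = 0 ∧ (r = v ∨ G.bl v r)
  min : mk v = 0 → ∀ u < i, mk u = 0 → G.bl v u → r ≤ u

theorem repCmd_spec {n : ℕ} {G : CorrelationGraph n} {s : Mem} (hB : Base G s) :
    ∀ v < n, RepSpec G (s 3) n v (repCmd.den s 4 v) := by
  have key := rep_induction (b := 20) (k := 0) (s := s)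
    (fun i s' => ∀ v < i, RepSpec G (s 3) n v (s' 4 v))
    (c := seqs [write 4 (var 20) (var 20), rep 21 0 (whenAll
    [notE (.read 3 (var 20)), notE (.read 3 (var 21)), adj (var 20) (var 21),
      .sub (.read 4 (var 20)) (var 21)]
    (write 4 (var 20) (var 21)))]) (by simp) ?_
  · rw [hB.size] at key
    exact key
  intro v s1 hv hf1 h20 hI
  have hB1 := hB.congr (hf1 0 (by decide)) (hf1 2 (by decide))
  rw [hB.size] at hv
  simp only [seqs, den, Expr.eval, h20, Mem.set_of_ne _ _ _ (show 4 ≠ 20 by decide)]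
  set s2 := s1.set 4 v v with hs2
  have hB2 : Base G s2 := hB1.congr (Mem.set_of_ne _ _ _ (by decide))
    (Mem.set_of_ne _ _ _ (by decide))
  have e3 : s2 3 = s 3 := by rw [hs2, Mem.set_of_ne _ _ _ (by decide), hf1 3 (by decide)]
  have e20 : s2 20 0 = v := by rw [hs2, Mem.set_of_ne _ _ _ (by decide), h20]
  have key := rep_induction (b := 21) (k := 0) (s := s2)
    (fun i s' => RepSpec G (s 3) i v (s' 4 v) ∧ ∀ u ≠ v, s' 4 u = s1 4 u)
    (c := whenAll
    [notE (.read 3 (var 20)), notE (.read 3 (var 21)), adj (var 20) (var 21),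
      .sub (.read 4 (var 20)) (var 21)]
    (write 4 (var 20) (var 21))) ?_ ?_
  · rw [hB2.size] at key
    intro u hu
    rcases Nat.lt_succ_iff_lt_or_eq.1 hu with hu | rfl
    · have := key.2 u (by omega)
      change RepSpec G (s 3) n u ((den (rep 21 0 _) s2) 4 u)
      rw [this]
      exact hI u hu
    · exact key.1
  · simp only [hs2, Mem.set_of_ne _ _ _ (show 4 ≠ 21 by decide), Mem.set_self]
    refine ⟨?_, fun u hu => Function.update_of_ne hu _ _⟩
    rw [Function.update_self]
    exact ⟨le_rfl, fun _ => rfl, fun h => ⟨h, Or.inl rfl⟩, by simp⟩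
  · rintro u s3 hu hf3 h21 ⟨hR, hne⟩
    have hB3 := hB2.congr (hf3 0 (by decide)) (hf3 2 (by decide))
    rw [hB2.size] at hu
    have e20' : s3 20 0 = v := by rw [hf3 20 (by decide), e20]
    have e3' : s3 3 = s 3 := by rw [hf3 3 (by decide), e3]
    have v20 : (var 20).eval s3 = v := e20'
    have v21 : (var 21).eval s3 = u := h21
    have a1 := hB3.eval_adj (x := var 20) (y := var 21) (by omega) (by omega)
    rw [Mem.set_of_ne _ _ _ (show 4 ≠ 21 by decide)]
    rw [den_whenAll]
    split_ifs with hcond <;> simp only [tests_cons, tests_nil, and_true, eval_notE, a1,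
      Expr.eval, e20', h21, e3'] at hcond
    · obtain ⟨m1, m2, b1, hlt⟩ := hcond
      simp only [den, Mem.set_self, Expr.eval, e20', h21]
      refine ⟨?_, fun w hw => by rw [Function.update_of_ne hw, hne w hw]⟩
      rw [Function.update_self]
      refine ⟨by have := hR.le; omega, fun h => absurd m1 h, fun _ => ⟨m2, Or.inr b1⟩, ?_⟩
      intro _ w hw mw bw
      rcases Nat.lt_succ_iff_lt_or_eq.1 hw with hw | rfl
      · have := hR.min m1 w hw mw bw
        omega
      · rfl
    · refine ⟨⟨hR.le, hR.marked, hR.unmarked, ?_⟩, hne⟩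
      intro m1 w hw mw bw
      rcases Nat.lt_succ_iff_lt_or_eq.1 hw with hw | rfl
      · exact hR.min m1 w hw mw bw
      · by_contra h
        exact hcond ⟨m1, mw, bw, by omega⟩

/-- Two unmarked vertices have the same representative if and only if they are in the same
cluster. -/
theorem RepSpec.eq_iff {n : ℕ} {G : CorrelationGraph n} {mk rp : ℕ → ℕ}
    (h : ∀ v < n, RepSpec G mk n v (rp v))
    (hbad : ∀ a b c, G.Bad a b c → mk a ≠ 0 ∨ mk b ≠ 0 ∨ mk c ≠ 0) {a b : ℕ} (ha : a < n)
    (hb : b < n) (ma : mk a = 0) (mb : mk b = 0) (hab : a ≠ b) : G.bl a b ↔ rp a = rp b := by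
  -- Since the packing is maximal, blue adjacency is transitive on unmarked vertices.
  have htr : ∀ x y z, mk x = 0 → mk y = 0 → mk z = 0 → x ≠ z → G.bl x y → G.bl y z → G.bl x z := by
    intro x y z mx my mz hxz hxy hyz
    by_contra hn
    rcases hbad x y z ⟨hxy, hyz, hxz, hn⟩ with h | h | h <;> exact h ‹_›
  have hle : ∀ a b, a < n → b < n → mk a = 0 → mk b = 0 → G.bl a b → rp a ≤ rp b := by
    intro a b ha hb ma mb hab
    obtain ⟨m1, h1⟩ := (h b hb).unmarked mb
    have hrb := (h b hb).le
    rcases h1 with h1 | h1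
    · rw [h1]
      exact (h a ha).min ma b hb mb hab
    · by_cases hne : a = rp b
      · exact hne ▸ (h a ha).le
      · exact (h a ha).min ma _ (by omega) m1 (htr _ _ _ ma mb m1 hne hab h1)
  constructor
  · intro h1
    exact le_antisymm (hle a b ha hb ma mb h1)
      (hle b a hb ha mb ma (CorrelationGraph.bl_symm h1))
  · intro heq
    obtain ⟨m1, h1⟩ := (h a ha).unmarked ma
    obtain ⟨m2, h2⟩ := (h b hb).unmarked mb
    rw [← heq] at h2
    rcases h1 with h1 | h1 <;> rcases h2 with h2 | h2
    · exact absurd (h1.symm.trans h2) hab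
    · rw [h1] at h2
      exact CorrelationGraph.bl_symm h2
    · rwa [h2] at h1
    · exact htr _ _ _ ma m1 mb hab h1 (CorrelationGraph.bl_symm h2)

/-! ### Carrying out the auction -/

/-- The price that the vertex in bank `20` has to pay at the vertex in bank `21`. -/
def priceE : Expr := .read 6 (ix (var 21) (.read 4 (var 20)))

/-- Finds the cheapest offer for the vertex in bank `20`. -/
def bestCmd : Cmd :=
  seqs [write 8 (.lit 0) (.lit 0), write 9 (.lit 0) (var 5),
    rep 21 0 (whenAll [.read 3 (var 21), adj (var 21) (var 20), .sub (var 9) priceE]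
      (seqs [write 8 (.lit 0) (.add (var 21) (.lit 1)), write 9 (.lit 0) priceE]))]

/-- Bank 8 holds the seller plus one, so 0 means that no offer is below the limit in bank 5. In that
case bank 9 still holds the limit, and the first conclusion says that the vertex is sated. -/
theorem bestCmd_spec {n : ℕ} {G : CorrelationGraph n} {s : Mem} (hB : Base G s) {a : ℕ}
    (ha : s 20 0 = a) (han : a < n) :
    (∀ w, s 3 w ≠ 0 → G.bl w a → bestCmd.den s 9 0 ≤ s 6 (w * n + s 4 a)) ∧
      ((bestCmd.den s 8 0 = 0 ∧ bestCmd.den s 9 0 = s 5 0) ∨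
        ∃ v, bestCmd.den s 8 0 = v + 1 ∧ s 3 v ≠ 0 ∧ G.bl v a ∧
          bestCmd.den s 9 0 = s 6 (v * n + s 4 a) ∧ bestCmd.den s 9 0 < s 5 0) := by
  set s1 := (s.set 8 0 0).set 9 0 (s 5 0) with hs1
  have hf1 : ∀ b, b ≠ 8 → b ≠ 9 → s1 b = s b := fun b h8 h9 => by
    rw [hs1, Mem.set_of_ne _ _ _ h9, Mem.set_of_ne _ _ _ h8]
  have hB1 : Base G s1 := hB.congr (hf1 0 (by decide) (by decide)) (hf1 2 (by decide) (by decide))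
  have key := rep_induction (b := 21) (k := 0) (s := s1)
    (fun i s' => (∀ w < i, s 3 w ≠ 0 → G.bl w a → s' 9 0 ≤ s 6 (w * n + s 4 a)) ∧
      ((s' 8 0 = 0 ∧ s' 9 0 = s 5 0) ∨
        ∃ v, s' 8 0 = v + 1 ∧ s 3 v ≠ 0 ∧ G.bl v a ∧
          s' 9 0 = s 6 (v * n + s 4 a) ∧ s' 9 0 < s 5 0))
    (c := whenAll [.read 3 (var 21), adj (var 21) (var 20), .sub (var 9) priceE]
      (seqs [write 8 (.lit 0) (.add (var 21) (.lit 1)), write 9 (.lit 0) priceE])) ?_ ?_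
  · rw [hB1.size] at key
    have e : bestCmd.den s = (rep 21 0 (whenAll [.read 3 (var 21), adj (var 21) (var 20),
        .sub (var 9) priceE] (seqs [write 8 (.lit 0) (.add (var 21) (.lit 1)),
          write 9 (.lit 0) priceE]))).den s1 := by
      simp only [bestCmd, seqs, den, Expr.eval]
      rw [Mem.set_of_ne _ _ _ (show 5 ≠ 8 by decide)]
    rw [e]
    exact ⟨fun w mw bw => key.1 w bw.1 mw bw, key.2⟩
  · refine ⟨by simp, Or.inl ⟨?_, ?_⟩⟩
    · rw [Mem.set_of_ne _ _ _ (by decide), hs1, Mem.set_of_ne _ _ _ (by decide), Mem.set_self]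
      simp
    · rw [Mem.set_of_ne _ _ _ (by decide), hs1, Mem.set_self]
      simp
  · rintro v s2 hv hf2 h21 ⟨h1, h2⟩
    have hB2 := hB1.congr (hf2 0 (by decide)) (hf2 2 (by decide))
    rw [hB1.size] at hv
    have e3 : s2 3 = s 3 := (hf2 3 (by decide)).trans (hf1 3 (by decide) (by decide))
    have e4 : s2 4 = s 4 := (hf2 4 (by decide)).trans (hf1 4 (by decide) (by decide))
    have e6 : s2 6 = s 6 := (hf2 6 (by decide)).trans (hf1 6 (by decide) (by decide))
    have e20 : s2 20 0 = a := by rw [hf2 20 (by decide), hf1 20 (by decide) (by decide), ha]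
    have v20 : (var 20).eval s2 = a := e20
    have v21 : (var 21).eval s2 = v := h21
    have a1 := hB2.eval_adj (x := var 21) (y := var 20) (by omega) (by omega)
    have a2 : priceE.eval s2 = s 6 (v * n + s 4 a) := by
      rw [priceE, Expr.eval, hB2.eval_ix (by omega), e6, v21]
      simp [Expr.eval, e4, e20]
    rw [den_whenAll, Mem.set_of_ne _ _ _ (show 9 ≠ 21 by decide),
      Mem.set_of_ne _ _ _ (show 8 ≠ 21 by decide)]
    split_ifs with hcond <;> simp only [tests_cons, tests_nil, and_true, a1, v20, v21] at hcond <;>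
      simp only [Expr.eval, a2, e3, h21] at hcond
    · obtain ⟨m, b, hlt⟩ := hcond
      have e9 : (seqs [write 8 (.lit 0) (.add (var 21) (.lit 1)), write 9 (.lit 0) priceE]).den s2 9 0
          = s 6 (v * n + s 4 a) := by
        have hB3 : Base G (s2.set 8 0 (v + 1)) :=
          hB2.congr (Mem.set_of_ne _ _ _ (by decide)) (Mem.set_of_ne _ _ _ (by decide))
        simp only [seqs, den, Expr.eval, h21]
        rw [Mem.set_self, Function.update_self, priceE, Expr.eval, hB3.eval_ix]
        · simp [Expr.eval, Mem.set_of_ne, e6, e4, e20, h21]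
        · simpa [Expr.eval, Mem.set_of_ne, h21] using hv
      have e8 : (seqs [write 8 (.lit 0) (.add (var 21) (.lit 1)), write 9 (.lit 0) priceE]).den s2 8 0
          = v + 1 := by
        simp only [seqs, den, Expr.eval, h21]
        rw [Mem.set_of_ne _ _ _ (by decide), Mem.set_self, Function.update_self]
      rw [e9, e8]
      refine ⟨fun w hw mw bw => ?_, Or.inr ⟨v, rfl, m, b, rfl, ?_⟩⟩
      · rcases Nat.lt_succ_iff_lt_or_eq.1 hw with hw | rfl
        · have := h1 w hw mw bw
          omega
        · rfl
      · rcases h2 with ⟨-, h2⟩ | ⟨u, -, -, -, -, h2⟩ <;> omega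
    · refine ⟨fun w hw mw bw => ?_, h2⟩
      rcases Nat.lt_succ_iff_lt_or_eq.1 hw with hw | rfl
      · exact h1 w hw mw bw
      · by_contra h
        exact hcond ⟨mw, bw, by omega⟩

/-- Carries out the bid of the vertex in bank `20`. -/
def bidCmd : Cmd :=
  seqs [rep 21 0 (whenAll [eqE (.read 7 (var 21)) (var 8), eqE (.read 4 (var 21)) (.read 4 (var 20))]
      (write 7 (var 21) (.lit 0))),
    write 7 (var 20) (var 8),
    write 6 (ix (.sub (var 8) (.lit 1)) (.read 4 (var 20))) (.add (var 9) (.lit 1))]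

/-- The expelling loop visits only the cells below `n`, whereas `bidMate` acts on all numbers;
`hmate` closes this difference. -/
theorem bidCmd_spec {n : ℕ} {G : CorrelationGraph n} {s : Mem} (hB : Base G s) {a v : ℕ}
    (ha : s 20 0 = a) (hv : v < n) (h8 : s 8 0 = v + 1)
    (h9 : s 9 0 = s 6 (v * n + s 4 a)) (hmate : ∀ b, s 7 b ≠ 0 → b < n) :
    bidCmd.den s 7 = bidMate (s 4) (s 7) a v ∧ bidCmd.den s 6 = bidPrice n (s 4) (s 6) a v := by
  have key := rep_induction (b := 21) (k := 0) (s := s)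
    (fun i s' => ∀ b, s' 7 b = if b < i ∧ s 7 b = v + 1 ∧ s 4 b = s 4 a then 0 else s 7 b)
    (c := whenAll [eqE (.read 7 (var 21)) (var 8), eqE (.read 4 (var 21)) (.read 4 (var 20))]
      (write 7 (var 21) (.lit 0))) ?_ ?_
  · rw [hB.size] at key
    set s1 := (rep 21 0 (whenAll [eqE (.read 7 (var 21)) (var 8),
      eqE (.read 4 (var 21)) (.read 4 (var 20))] (write 7 (var 21) (.lit 0)))).den s with hs1
    have hf : ∀ b ∉ [21, 7], s1 b = s b := fun b hb => den_frame _ _ _ hb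
    have hB1 : Base G s1 := hB.congr (hf 0 (by decide)) (hf 2 (by decide))
    have hd : bidCmd.den s = (s1.set 7 a (v + 1)).set 6 (v * n + s 4 a)
        (s 6 (v * n + s 4 a) + 1) := by
      have hB2 : Base G (s1.set 7 a (v + 1)) :=
        hB1.congr (Mem.set_of_ne _ _ _ (by decide)) (Mem.set_of_ne _ _ _ (by decide))
      have v8 : s1 8 0 = v + 1 := by rw [hf 8 (by decide), h8]
      have v20 : s1 20 0 = a := by rw [hf 20 (by decide), ha]
      have v9 : s1 9 0 = s 6 (v * n + s 4 a) := by rw [hf 9 (by decide), h9]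
      have w8 : (Expr.sub (var 8) (.lit 1)).eval (s1.set 7 a (v + 1)) = v := by
        simp [Expr.eval, Mem.set_of_ne, v8]
      have w4 : (Expr.read 4 (var 20)).eval (s1.set 7 a (v + 1)) = s 4 a := by
        simp [Expr.eval, Mem.set_of_ne, v20, hf 4 (by decide)]
      simp only [bidCmd, seqs, den_seq, den_write]
      rw [← hs1]
      have e1 : (var 20).eval s1 = a := v20
      have e2 : (var 8).eval s1 = v + 1 := v8
      rw [e1, e2, hB2.eval_ix (by omega), w8, w4]
      simp [Expr.eval, Mem.set_of_ne, v9]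
    rw [hd]
    constructor
    · rw [Mem.set_of_ne _ _ _ (by decide), Mem.set_self]
      funext b
      by_cases hb : b = a
      · simp [bidMate, hb]
      · rw [Function.update_of_ne hb, bidMate, if_neg hb, key b]
        by_cases hm : s 7 b = v + 1
        · simp [hm, hmate b (by omega)]
        · simp [hm]
    · rw [Mem.set_self, Mem.set_of_ne _ _ _ (by decide), hf 6 (by decide)]
      rfl
  · simp [Mem.set_of_ne]
  · intro i s1 hi hf h21 hI b
    have e20 : s1 20 0 = a := by rw [hf 20 (by decide), ha]
    have e4 : s1 4 = s 4 := hf 4 (by decide)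
    have e8 : s1 8 0 = v + 1 := by rw [hf 8 (by decide), h8]
    have e7 : s1 7 i = s 7 i := by rw [hI i, if_neg (by omega)]
    rw [den_whenAll, Mem.set_of_ne _ _ _ (by decide)]
    split_ifs with hcond hc hc <;> simp only [tests_cons, tests_nil, and_true, eval_eqE,
      Expr.eval, e20, h21, e4, e8, e7] at hcond
    · simp only [den, Expr.eval, h21, Mem.set_self, Function.update_apply]
      split_ifs with h
      · rfl
      · rw [hI b, if_pos ⟨by omega, hc.2⟩]
    · simp only [den, Expr.eval, h21, Mem.set_self, Function.update_apply]
      split_ifs with h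
      · subst h
        exact absurd ⟨by omega, hcond⟩ hc
      · rw [hI b, if_neg fun h' => hc ⟨by omega, h'.2⟩]
    · have hne : b ≠ i := by
        rintro rfl
        exact hcond hc.2
      rw [hI b, if_pos ⟨by omega, hc.2⟩]
    · rw [hI b, if_neg fun h' => hc ⟨by omega, h'.2⟩]

def offerCmd : Cmd :=
  whenAll [notE (.read 3 (var 20)), notE (.read 7 (var 20))]
    (seqs [bestCmd, whenAll [var 8] bidCmd])

/-- The state of the memory during the auction. -/
structure AuctionState {n : ℕ} (G : CorrelationGraph n) (mk rp : ℕ → ℕ) (N : ℕ) (s : Mem) :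
    Prop where
  base : Base G s
  mk_eq : s 3 = mk
  rp_eq : s 4 = rp
  N_eq : s 5 0 = N
  inv : AuctionInv G mk rp N (s 6) (s 7)

theorem AuctionState.set {n : ℕ} {G : CorrelationGraph n} {mk rp : ℕ → ℕ} {N : ℕ} {s : Mem}
    (h : AuctionState G mk rp N s) (b x : ℕ) (hb : 10 ≤ b) :
    AuctionState G mk rp N (s.set b 0 x) := by
  have hf : ∀ b' < 10, s.set b 0 x b' = s b' := fun b' hb' => Mem.set_of_ne _ _ _ (by omega)
  exact ⟨h.base.congr (hf 0 (by decide)) (hf 2 (by decide)), by rw [hf 3 (by decide), h.mk_eq],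
    by rw [hf 4 (by decide), h.rp_eq], by rw [hf 5 (by decide), h.N_eq],
    by rw [hf 6 (by decide), hf 7 (by decide)]; exact h.inv⟩

section

variable {n : ℕ} {G : CorrelationGraph n} {mk rp : ℕ → ℕ} {N : ℕ} {s : Mem}

/-- The dichotomy behind termination: either the vertex was already sated and prices and mates are
unchanged, or a bid raised the total price by exactly one. -/
theorem offerCmd_spec (h : AuctionState G mk rp N s) (hrp : ∀ a < n, rp a < n) {a : ℕ}
    (ha : s 20 0 = a) (han : a < n) :
    AuctionState G mk rp N (offerCmd.den s) ∧
      ((Sated G mk rp N (s 6) (s 7) a ∧ offerCmd.den s 6 = s 6 ∧ offerCmd.den s 7 = s 7) ∨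
       (¬ Sated G mk rp N (s 6) (s 7) a ∧ ∑ q ∈ Finset.range (n * n), offerCmd.den s 6 q =
          ∑ q ∈ Finset.range (n * n), s 6 q + 1)) := by
  have hfr : ∀ b ∉ offerCmd.banks, offerCmd.den s b = s b := fun b => den_frame _ _ _
  have suff : AuctionInv G mk rp N (offerCmd.den s 6) (offerCmd.den s 7) →
      AuctionState G mk rp N (offerCmd.den s) := fun hinv =>
    ⟨h.base.congr (hfr 0 (by decide)) (hfr 2 (by decide)), by rw [hfr 3 (by decide), h.mk_eq],
      by rw [hfr 4 (by decide), h.rp_eq], by rw [hfr 5 (by decide), h.N_eq], hinv⟩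
  clear hfr
  suffices h' : AuctionInv G mk rp N (offerCmd.den s 6) (offerCmd.den s 7) ∧
      ((Sated G mk rp N (s 6) (s 7) a ∧ offerCmd.den s 6 = s 6 ∧ offerCmd.den s 7 = s 7) ∨
       (¬ Sated G mk rp N (s 6) (s 7) a ∧ ∑ q ∈ Finset.range (n * n), offerCmd.den s 6 q =
          ∑ q ∈ Finset.range (n * n), s 6 q + 1)) from ⟨suff h'.1, h'.2⟩
  clear suff
  rw [offerCmd, den_whenAll]
  split_ifs with hcond <;> simp only [tests_cons, tests_nil, and_true, eval_notE, Expr.eval, ha,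
    h.mk_eq] at hcond
  · obtain ⟨hma, hua⟩ := hcond
    have hf : ∀ b ∉ bestCmd.banks, bestCmd.den s b = s b := fun b => den_frame _ _ _
    obtain ⟨h1, h2⟩ := bestCmd_spec h.base ha han
    simp only [seqs, den]
    rw [den_whenAll]
    rw [h.mk_eq, h.rp_eq, h.N_eq] at h2
    rw [h.mk_eq, h.rp_eq] at h1
    split_ifs with hc <;> simp only [tests_cons, tests_nil, and_true, Expr.eval] at hc
    · rcases h2 with ⟨h2, -⟩ | ⟨v, h8, hv, hbl, h9, hlt⟩
      · exact absurd h2 hc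
      · have hB' : Base G (bestCmd.den s) := h.base.congr (hf 0 (by decide)) (hf 2 (by decide))
        obtain ⟨e7, e6⟩ := bidCmd_spec (a := a) (v := v) hB' (by rw [hf 20 (by decide), ha]) hbl.1
          h8 (by rw [h9, hf 6 (by decide), hf 4 (by decide), h.rp_eq]) (fun b hb => by
            rw [hf 7 (by decide)] at hb
            obtain ⟨u, hu⟩ := Nat.exists_eq_succ_of_ne_zero hb
            exact (h.inv.mate_spec b u hu).2.2.2.1)
        rw [hf 4 (by decide), hf 7 (by decide), h.rp_eq] at e7
        rw [hf 4 (by decide), hf 6 (by decide), h.rp_eq] at e6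
        rw [e6, e7]
        refine ⟨h.inv.bid hrp hma hua hv hbl (fun w hw hbw => h9 ▸ h1 w hw hbw) (h9 ▸ hlt),
          Or.inr ⟨fun hs => ?_, sum_bidPrice hbl.1 (hrp a han)⟩⟩
        have := hs hma hua v hv hbl
        omega
    · rw [hf 6 (by decide), hf 7 (by decide)]
      refine ⟨h.inv, Or.inl ⟨fun _ _ v hv hbl => ?_, rfl, rfl⟩⟩
      rcases h2 with ⟨-, h2⟩ | ⟨v, h8, -⟩
      · exact h2 ▸ h1 v hv hbl
      · omega
  · exact ⟨h.inv, Or.inl ⟨fun h1 h2 => absurd ⟨h1, h2⟩ hcond, rfl, rfl⟩⟩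

/-- Until the first bid of a round, prices and mates are those at its start, so a round without bids
tests every vertex against one and the same state. -/
theorem round_spec (h : AuctionState G mk rp N s) (hrp : ∀ a < n, rp a < n) :
    AuctionState G mk rp N ((rep 20 0 offerCmd).den s) ∧
      (((∀ a < n, Sated G mk rp N (s 6) (s 7) a) ∧ (rep 20 0 offerCmd).den s 6 = s 6 ∧
          (rep 20 0 offerCmd).den s 7 = s 7) ∨
       ((¬ ∀ a < n, Sated G mk rp N (s 6) (s 7) a) ∧ ∑ q ∈ Finset.range (n * n), s 6 q + 1 ≤
        ∑ q ∈ Finset.range (n * n), (rep 20 0 offerCmd).den s 6 q)) := by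
  have key := rep_induction (b := 20) (k := 0) (s := s) (c := offerCmd)
    (fun i s' => AuctionState G mk rp N s' ∧
      (((∀ a < i, Sated G mk rp N (s 6) (s 7) a) ∧ s' 6 = s 6 ∧ s' 7 = s 7) ∨
       ((¬ ∀ a < n, Sated G mk rp N (s 6) (s 7) a) ∧ ∑ q ∈ Finset.range (n * n), s 6 q + 1 ≤
        ∑ q ∈ Finset.range (n * n), s' 6 q)))
    ⟨h.set _ _ (by decide), Or.inl ⟨by simp, by rw [Mem.set_of_ne _ _ _ (by decide)],
      by rw [Mem.set_of_ne _ _ _ (by decide)]⟩⟩ ?_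
  · rw [h.base.size] at key
    exact key
  · rintro a s' ha hf h20 ⟨h1, h2⟩
    rw [h.base.size] at ha
    obtain ⟨h3, h4⟩ := offerCmd_spec h1 hrp h20 ha
    refine ⟨h3.set _ _ (by decide), ?_⟩
    rw [Mem.set_of_ne _ _ _ (show 6 ≠ 20 by decide), Mem.set_of_ne _ _ _ (show 7 ≠ 20 by decide)]
    rcases h2 with ⟨h5, h6, h7⟩ | ⟨h5, h6⟩
    · rw [h6, h7] at h4
      rcases h4 with ⟨h8, h9⟩ | ⟨h8, h9⟩
      · refine Or.inl ⟨fun b hb => ?_, h9⟩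
        rcases Nat.lt_succ_iff_lt_or_eq.1 hb with hb | rfl
        · exact h5 b hb
        · exact h8
      · exact Or.inr ⟨fun h' => h8 (h' a ha), h9.ge⟩
    · refine Or.inr ⟨h5, ?_⟩
      rcases h4 with ⟨-, h8, -⟩ | ⟨-, h8⟩
      · rwa [h8]
      · omega

/-- The number of rounds is (n + 2)⁴, fixed in advance as counted loops require. Rounds after the
end of the auction change neither prices nor mates. -/
def auctionCmd : Cmd := rep 22 2 (rep 23 2 (rep 24 2 (rep 25 2 (rep 20 0 offerCmd))))

theorem auctionCmd_spec (h : AuctionState G mk rp ((n + 2) * (n + 2)) s)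
    (hrp : ∀ a < n, rp a < n) :
    AuctionState G mk rp ((n + 2) * (n + 2)) (auctionCmd.den s) ∧
      ∀ a < n, Sated G mk rp ((n + 2) * (n + 2)) (auctionCmd.den s 6) (auctionCmd.den s 7) a := by
  let I : ℕ → Mem → Prop := fun r s => AuctionState G mk rp ((n + 2) * (n + 2)) s ∧
    ((∀ a < n, Sated G mk rp ((n + 2) * (n + 2)) (s 6) (s 7) a) ∨
      r ≤ ∑ q ∈ Finset.range (n * n), s 6 q)
  have hset : ∀ b, 10 ≤ b → ∀ t s x, I t s → I t (s.set b 0 x) := by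
    rintro b hb t s x ⟨h1, h2⟩
    refine ⟨h1.set _ _ hb, ?_⟩
    rwa [Mem.set_of_ne _ _ _ (by omega), Mem.set_of_ne _ _ _ (by omega)]
  have h1 : ∀ t s, s 0 0 = n → I t s → I (t + 1) ((rep 20 0 offerCmd).den s) := by
    rintro t s - ⟨h1, h2⟩
    obtain ⟨h3, h4⟩ := round_spec h1 hrp
    refine ⟨h3, ?_⟩
    rcases h4 with ⟨h4, h5, h6⟩ | ⟨h4, h5⟩
    · rw [h5, h6]
      exact Or.inl h4
    · rcases h2 with h2 | h2
      · exact absurd h2 h4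
      · right
        omega
  have h2 := fun t s => rep_count (k := 2) I _ (hset 25 (by decide)) (by decide) h1 t s
  have h3 := fun t s => rep_count (k := 2) I _ (hset 24 (by decide)) (by decide) h2 t s
  have h4 := fun t s => rep_count (k := 2) I _ (hset 23 (by decide)) (by decide) h3 t s
  have h5 := rep_count (k := 2) I _ (hset 22 (by decide)) (by decide) h4 0 s h.base.size ⟨h, Or.inr (by simp)⟩
  refine ⟨h5.1, h5.2.resolve_right fun h6 => ?_⟩
  have h7 : ∑ q ∈ Finset.range (n * n), auctionCmd.den s 6 q ≤ n * n * ((n + 2) * (n + 2)) := by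
    have h50 : AuctionState G mk rp ((n + 2) * (n + 2)) (auctionCmd.den s) := h5.1
    simpa using Finset.sum_le_card_nsmul (Finset.range (n * n)) _ _ fun q _ => h50.inv.le q
  have h8 := h6.trans h7
  -- If some vertex were still unsated, every round would have raised the total price, to at least
  -- (n + 2)⁴; but n² prices of at most (n + 2)² sum to less.
  nlinarith

end

/-- Nested counting replaces the multiplication (n + 2) · (n + 2), which the machine lacks. -/
def limitCmd : Cmd := rep 20 2 (rep 21 2 (write 5 (.lit 0) (.add (var 5) (.lit 1))))

theorem limitCmd_spec {s : Mem} (h : s 5 0 = 0) :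
    limitCmd.den s 5 0 = (s 0 0 + 2) * (s 0 0 + 2) := by
  let I : ℕ → Mem → Prop := fun r s => s 5 0 = r
  have hset : ∀ b, 10 ≤ b → ∀ t s x, I t s → I t (s.set b 0 x) := by
    intro b hb t s x h1
    change _ = _
    rwa [Mem.set_of_ne _ _ _ (by omega)]
  have h1 : ∀ t s', s' 0 0 = s 0 0 → I t s' →
      I (t + 1) ((write 5 (.lit 0) (.add (var 5) (.lit 1))).den s') := by
    intro t s' _ h1
    have h1' : s' 5 0 = t := h1
    simp [I, den, Expr.eval, Mem.set_self, h1']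
  have h2 := fun t s' => rep_count (k := 2) (n := s 0 0) I _ (hset 21 (by decide)) (by decide) h1 t s'
  have h3 := rep_count (k := 2) (n := s 0 0) I _ (hset 20 (by decide)) (by decide) h2 0 s rfl h
  have h4 : limitCmd.den s 5 0 = _ := h3
  rw [h4]
  ring

/-! ### The price gap, the vertex cover, and the pairs to be created -/

/-- Tests whether the number in bank `15` occurs as a price. -/
def findCmd : Cmd :=
  seqs [write 14 (.lit 0) (.lit 0), rep 20 0 (rep 21 0 (whenAll
    [eqE (.read 6 (ix (var 20) (var 21))) (var 15)] (write 14 (.lit 0) (.lit 1))))]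

theorem findCmd_spec {n : ℕ} {G : CorrelationGraph n} {s : Mem} (hB : Base G s) :
    findCmd.den s 14 0 = 0 ↔ ∀ v < n, ∀ c < n, s 6 (v * n + c) ≠ s 15 0 := by
  have hd : findCmd.den s = (rep 20 0 (rep 21 0 (whenAll
    [eqE (.read 6 (ix (var 20) (var 21))) (var 15)] (write 14 (.lit 0) (.lit 1))))).den
      (s.set 14 0 0) := rfl
  rw [hd]
  set s0 := s.set 14 0 0 with hs0
  have hf0 : ∀ b ≠ 14, s0 b = s b := fun b hb => Mem.set_of_ne _ _ _ hb
  have hB0 : Base G s0 := hB.congr (hf0 0 (by decide)) (hf0 2 (by decide))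
  have key := rep_induction (b := 20) (k := 0) (s := s0) (c := rep 21 0 (whenAll
    [eqE (.read 6 (ix (var 20) (var 21))) (var 15)] (write 14 (.lit 0) (.lit 1))))
    (fun i s' => s' 14 0 = 0 ↔ ∀ v < i, ∀ c < n, s 6 (v * n + c) ≠ s 15 0)
    (by simp [hs0, Mem.set_of_ne, Mem.set_self]) ?_
  · rw [hB0.size] at key
    exact key
  intro v s1 hv hf1 h20 hI
  have hB1 := hB0.congr (hf1 0 (by decide)) (hf1 2 (by decide))
  rw [hB0.size] at hv
  have key := rep_induction (b := 21) (k := 0) (s := s1) (c := whenAll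
    [eqE (.read 6 (ix (var 20) (var 21))) (var 15)] (write 14 (.lit 0) (.lit 1)))
    (fun j s' => s' 14 0 = 0 ↔ (∀ u < v, ∀ c < n, s 6 (u * n + c) ≠ s 15 0) ∧
      ∀ c < j, s 6 (v * n + c) ≠ s 15 0)
    (by simpa [Mem.set_of_ne] using hI) ?_
  · rw [hB1.size] at key
    rw [Mem.set_of_ne _ _ _ (show 14 ≠ 20 by decide)]
    refine key.trans ⟨fun h u hu => ?_, fun h => ⟨fun u hu => h u (by omega), h v (by omega)⟩⟩
    rcases Nat.lt_succ_iff_lt_or_eq.1 hu with hu | rfl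
    · exact h.1 u hu
    · exact h.2
  intro c s2 hc hf2 h21 hI
  have hB2 := hB1.congr (hf2 0 (by decide)) (hf2 2 (by decide))
  have v20 : (var 20).eval s2 = v := by
    rw [Expr.eval, Expr.eval, hf2 20 (by decide), h20]
  have v21 : (var 21).eval s2 = c := h21
  have e1 := hB2.eval_ix (x := var 20) (y := var 21) (by omega)
  have e15 : s2 15 = s 15 := by
    rw [hf2 15 (by decide), hf1 15 (by decide), hf0 15 (by decide)]
  have e6 : s2 6 = s 6 := by
    rw [hf2 6 (by decide), hf1 6 (by decide), hf0 6 (by decide)]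
  rw [den_whenAll, Mem.set_of_ne _ _ _ (show 14 ≠ 21 by decide)]
  split_ifs with hcond <;> simp only [tests_cons, tests_nil, and_true, eval_eqE] at hcond <;>
    rw [Expr.eval, e1, v20, v21, e6, Expr.eval, Expr.eval, e15] at hcond
  · refine iff_of_false (by simp [den, Expr.eval, Mem.set_self]) fun h => ?_
    exact h.2 c (by omega) hcond
  · refine hI.trans (and_congr_right fun _ => ⟨fun h d hd => ?_, fun h d hd => h d (by omega)⟩)
    rcases Nat.lt_succ_iff_lt_or_eq.1 hd with hd | rfl
    · exact h d hd
    · exact hcond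

/-- Finds a positive number below `(n + 2) ^ 2` that is not a price. -/
def gapCmd : Cmd :=
  rep 22 2 (rep 23 2 (seqs [findCmd, whenAll [notE (var 14), var 15] (write 11 (.lit 0) (var 15)),
    write 15 (.lit 0) (.add (var 15) (.lit 1))]))

def IsGap (n : ℕ) (p : ℕ → ℕ) (g : ℕ) : Prop :=
  1 ≤ g ∧ g < (n + 2) * (n + 2) ∧ ∀ v < n, ∀ c < n, p (v * n + c) ≠ g

/-- Bank 15 runs through the candidates, and bank 11 keeps the last gap found, if there was one;
`exists_gap` says there is one. The test of bank 15 itself excludes the candidate 0. -/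
theorem gapCmd_spec {n : ℕ} {G : CorrelationGraph n} {s : Mem} (hB : Base G s)
    (h15 : s 15 0 = 0) : IsGap n (s 6) (gapCmd.den s 11 0) := by
  let P : ℕ → Prop := fun g => 1 ≤ g ∧ ∀ v < n, ∀ c < n, s 6 (v * n + c) ≠ g
  let I : ℕ → Mem → Prop := fun t s' => Base G s' ∧ s' 6 = s 6 ∧ s' 15 0 = t ∧
    ((∃ g < t, P g) → s' 11 0 < t ∧ P (s' 11 0))
  have hset : ∀ b, 20 ≤ b → ∀ t s x, I t s → I t (s.set b 0 x) := by
    rintro b hb t s x ⟨h1, h2⟩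
    have hf : ∀ b' < 20, s.set b 0 x b' = s b' := fun b' hb' => Mem.set_of_ne _ _ _ (by omega)
    refine ⟨h1.congr (hf 0 (by decide)) (hf 2 (by decide)), ?_⟩
    rwa [hf 6 (by decide), hf 15 (by decide), hf 11 (by decide)]
  have h1 : ∀ t s, s 0 0 = n → I t s → I (t + 1) ((seqs [findCmd, whenAll [notE (var 14), var 15]
      (write 11 (.lit 0) (var 15)), write 15 (.lit 0) (.add (var 15) (.lit 1))]).den s) := by
    rintro t s' - ⟨h1, h2, h3, h4⟩
    have hf : ∀ b ∉ findCmd.banks, findCmd.den s' b = s' b := fun b => den_frame _ _ _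
    have hfind := findCmd_spec h1
    simp only [seqs, den_seq]
    set s1 := findCmd.den s' with hs1
    have hB1 : Base G s1 := h1.congr (hf 0 (by decide)) (hf 2 (by decide))
    have e15 : s1 15 0 = t := by rw [hf 15 (by decide), h3]
    have e6 : s1 6 = s 6 := by rw [hf 6 (by decide), h2]
    have e11 : s1 11 = s' 11 := hf 11 (by decide)
    rw [h2, h3] at hfind
    rw [den_whenAll]
    split_ifs with hcond <;> simp only [tests_cons, tests_nil, and_true, eval_notE, Expr.eval, e15,
      hfind] at hcond
    · simp only [den, Expr.eval, e15]
      refine ⟨hB1.congr ?_ ?_, ?_, ?_, fun _ => ?_⟩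
      · rw [Mem.set_of_ne _ _ _ (by decide), Mem.set_of_ne _ _ _ (by decide)]
      · rw [Mem.set_of_ne _ _ _ (by decide), Mem.set_of_ne _ _ _ (by decide)]
      · rw [Mem.set_of_ne _ _ _ (by decide), Mem.set_of_ne _ _ _ (by decide), e6]
      · simp [Mem.set_self, Mem.set_of_ne, e15]
      · rw [Mem.set_of_ne _ _ _ (by decide), Mem.set_self, Function.update_self]
        exact ⟨by omega, by omega, hcond.1⟩
    · simp only [den, Expr.eval, e15]
      refine ⟨hB1.congr ?_ ?_, ?_, ?_, fun h5 => ?_⟩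
      · rw [Mem.set_of_ne _ _ _ (by decide)]
      · rw [Mem.set_of_ne _ _ _ (by decide)]
      · rw [Mem.set_of_ne _ _ _ (by decide), e6]
      · simp [Mem.set_self]
      · rw [Mem.set_of_ne _ _ _ (by decide), e11]
        obtain ⟨g, hg, hP⟩ := h5
        have := h4 ⟨g, ?_, hP⟩
        · exact ⟨by omega, this.2⟩
        · rcases Nat.lt_succ_iff_lt_or_eq.1 hg with hg | rfl
          · exact hg
          · exact absurd ⟨hP.2, by have := hP.1; omega⟩ hcond
  have h2 := fun t s => rep_count (k := 2) I _ (hset 23 (by decide)) (by decide) h1 t s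
  have h3 := rep_count (k := 2) I _ (hset 22 (by decide)) (by decide) h2 0 s hB.size
    ⟨hB, rfl, h15, by simp⟩
  obtain ⟨-, -, -, h4⟩ := h3
  obtain ⟨g, hg1, hg2, hg3⟩ := exists_gap (n := n) (s 6)
  have := h4 ⟨g, by simpa using hg2, hg1, fun v hv c hc => hg3 _ (index_lt hv hc)⟩
  have hlt : gapCmd.den s 11 0 < 0 + (n + 2) * ((n + 2) * 1) := this.1
  exact ⟨this.2.1, by simpa using hlt, this.2.2⟩

/-- Determines the vertices that are split. -/
def splitSetCmd : Cmd :=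
  rep 20 0 (seqs [write 10 (var 20) (.read 3 (var 20)), rep 21 0 (whenAll
    [notE (.read 3 (var 20)), .read 3 (var 21), adj (var 21) (var 20), .sub (var 11) priceE]
    (write 10 (var 20) (.lit 1)))])

/-- The unmarked vertex `a` belongs to the vertex cover. -/
def InCover {n : ℕ} (G : CorrelationGraph n) (mk rp p : ℕ → ℕ) (g a : ℕ) : Prop :=
  mk a = 0 ∧ ∃ v, mk v ≠ 0 ∧ G.bl v a ∧ p (v * n + rp a) < g

theorem splitSetCmd_spec {n : ℕ} {G : CorrelationGraph n} {s : Mem} (hB : Base G s) :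
    ∀ a < n, (splitSetCmd.den s 10 a ≠ 0 ↔ s 3 a ≠ 0 ∨ InCover G (s 3) (s 4) (s 6) (s 11 0) a) := by
  have key := rep_induction (b := 20) (k := 0) (s := s) (c := seqs
    [write 10 (var 20) (.read 3 (var 20)), rep 21 0 (whenAll
    [notE (.read 3 (var 20)), .read 3 (var 21), adj (var 21) (var 20), .sub (var 11) priceE]
    (write 10 (var 20) (.lit 1)))])
    (fun i s' => ∀ a < i, (s' 10 a ≠ 0 ↔ s 3 a ≠ 0 ∨ InCover G (s 3) (s 4) (s 6) (s 11 0) a))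
    (by simp) ?_
  · rw [hB.size] at key
    exact key
  intro a s1 ha hf1 h20 hI
  have hB1 := hB.congr (hf1 0 (by decide)) (hf1 2 (by decide))
  rw [hB.size] at ha
  rw [Mem.set_of_ne _ _ _ (by decide)]
  simp only [seqs, den_seq, den_write]
  set s2 := s1.set 10 ((var 20).eval s1) ((Expr.read 3 (var 20)).eval s1) with hs2
  have e2 : s2 10 = Function.update (s1 10) a (s 3 a) := by
    simp [hs2, Mem.set_self, Expr.eval, h20, hf1 3 (by decide)]
  have hf2 : ∀ b ≠ 10, s2 b = s1 b := fun b hb => Mem.set_of_ne _ _ _ hb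
  have hB2 : Base G s2 := hB1.congr (hf2 0 (by decide)) (hf2 2 (by decide))
  have key := rep_induction (b := 21) (k := 0) (s := s2) (c := whenAll
    [notE (.read 3 (var 20)), .read 3 (var 21), adj (var 21) (var 20), .sub (var 11) priceE]
    (write 10 (var 20) (.lit 1)))
    (fun i s' => (∀ b ≠ a, s' 10 b = s1 10 b) ∧ (s' 10 a ≠ 0 ↔ s 3 a ≠ 0 ∨ (s 3 a = 0 ∧
      ∃ v < i, s 3 v ≠ 0 ∧ G.bl v a ∧ s 6 (v * n + s 4 a) < s 11 0))) ?_ ?_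
  · rw [hB2.size] at key
    intro b hb
    rcases Nat.lt_succ_iff_lt_or_eq.1 hb with hb | rfl
    · rw [key.1 b (by omega)]
      exact hI b hb
    · rw [key.2, InCover]
      refine or_congr_right (and_congr_right fun _ => exists_congr fun v => ?_)
      exact ⟨fun h => h.2, fun h => ⟨h.2.1.1, h⟩⟩
  · rw [Mem.set_of_ne _ _ _ (by decide), e2]
    exact ⟨fun b hb => Function.update_of_ne hb _ _, by simp⟩
  rintro v s3 hv hf3 h21 ⟨h1, h2⟩
  have hB3 := hB2.congr (hf3 0 (by decide)) (hf3 2 (by decide))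
  rw [hB2.size] at hv
  have hf : ∀ b ∉ [20, 21, 10], s3 b = s b := by
    intro b hb
    rw [hf3 b (fun h => hb (by revert h; simp [banks, whenAll]; tauto)), hf2 b (by simp at hb; tauto),
      hf1 b (fun h => hb (by revert h; simp [banks, whenAll, seqs]; tauto))]
  have e20 : s3 20 0 = a := by rw [hf3 20 (by decide), hf2 20 (by decide), h20]
  have v20 : (var 20).eval s3 = a := e20
  have v21 : (var 21).eval s3 = v := h21
  have a1 := hB3.eval_adj (x := var 21) (y := var 20) (by omega) (by omega)
  have a2 : priceE.eval s3 = s 6 (v * n + s 4 a) := by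
    rw [priceE, Expr.eval, hB3.eval_ix (by omega), hf 6 (by decide), v21]
    simp [Expr.eval, hf 4 (by decide), e20]
  rw [den_whenAll, Mem.set_of_ne _ _ _ (show 10 ≠ 21 by decide)]
  split_ifs with hcond <;> simp only [tests_cons, tests_nil, and_true, eval_notE, a1, v20, v21]
      at hcond <;>
    simp only [Expr.eval, a2, hf 3 (by decide), hf 11 (by decide), h21, e20] at hcond
  · rw [den_write, v20, Mem.set_self]
    refine ⟨fun b hb => by rw [Function.update_of_ne hb, h1 b hb], ?_⟩
    rw [Function.update_self]
    exact iff_of_true (by simp [Expr.eval])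
      (Or.inr ⟨hcond.1, v, by omega, hcond.2.1, hcond.2.2.1, by omega⟩)
  · refine ⟨h1, h2.trans (or_congr_right (and_congr_right fun h0 => ⟨?_, ?_⟩))⟩
    · rintro ⟨w, hw, h⟩
      exact ⟨w, by omega, h⟩
    · rintro ⟨w, hw, h⟩
      rcases Nat.lt_succ_iff_lt_or_eq.1 hw with hw | rfl
      · exact ⟨w, hw, h⟩
      · exact absurd ⟨h0, h.1, h.2.1, by omega⟩ hcond

/-- Determines the pairs of a split vertex and a cluster that receives a copy of it. -/
def pairsCmd : Cmd :=
  rep 20 0 (rep 21 0 (ite (.sub (.read 6 (ix (var 20) (var 21))) (var 11))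
    (write 12 (ix (var 20) (var 21)) (.lit 1))
    (whenAll [.read 10 (var 20), eqE (.read 4 (var 20)) (var 21)]
      (write 12 (ix (var 20) (var 21)) (.lit 1)))))

theorem pairsCmd_spec {n : ℕ} {G : CorrelationGraph n} {s : Mem} (hB : Base G s)
    (h12 : s 12 = fun _ => 0) :
    ∀ v < n, ∀ c < n, (pairsCmd.den s 12 (v * n + c) ≠ 0 ↔
      s 11 0 < s 6 (v * n + c) ∨ (s 10 v ≠ 0 ∧ s 4 v = c)) := by
  let Q : ℕ → ℕ → Prop := fun v c => s 11 0 < s 6 (v * n + c) ∨ (s 10 v ≠ 0 ∧ s 4 v = c)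
  have key := rep_induction (b := 20) (k := 0) (s := s) (c := rep 21 0
    (ite (.sub (.read 6 (ix (var 20) (var 21))) (var 11))
    (write 12 (ix (var 20) (var 21)) (.lit 1))
    (whenAll [.read 10 (var 20), eqE (.read 4 (var 20)) (var 21)]
      (write 12 (ix (var 20) (var 21)) (.lit 1)))))
    (fun i s' => ∀ v < n, ∀ c < n, (s' 12 (v * n + c) ≠ 0 ↔ v < i ∧ Q v c))
    (by simp [Mem.set_of_ne, h12]) ?_
  · rw [hB.size] at key
    exact fun v hv c hc => (key v hv c hc).trans (and_iff_right hv)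
  intro v s1 hv hf1 h20 hI
  have hB1 := hB.congr (hf1 0 (by decide)) (hf1 2 (by decide))
  rw [hB.size] at hv
  rw [Mem.set_of_ne _ _ _ (by decide)]
  have key := rep_induction (b := 21) (k := 0) (s := s1) (c :=
    (ite (.sub (.read 6 (ix (var 20) (var 21))) (var 11))
    (write 12 (ix (var 20) (var 21)) (.lit 1))
    (whenAll [.read 10 (var 20), eqE (.read 4 (var 20)) (var 21)]
      (write 12 (ix (var 20) (var 21)) (.lit 1)))))
    (fun j s' => ∀ u < n, ∀ c < n, (s' 12 (u * n + c) ≠ 0 ↔ (u < v ∨ u = v ∧ c < j) ∧ Q u c)) ?_ ?_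
  · rw [hB1.size] at key
    intro u hu c hc
    refine (key u hu c hc).trans (and_congr_left fun _ => ?_)
    omega
  · intro u hu c hc
    rw [Mem.set_of_ne _ _ _ (by decide), hI u hu c hc]
    simp
  intro c s2 hc hf2 h21 hI2 u hu d hd
  have hB2 := hB1.congr (hf2 0 (by decide)) (hf2 2 (by decide))
  rw [hB1.size] at hc
  have e20 : s2 20 0 = v := by rw [hf2 20 (by decide), h20]
  have v20 : (var 20).eval s2 = v := e20
  have v21 : (var 21).eval s2 = c := h21
  have e1 := hB2.eval_ix (x := var 20) (y := var 21) (by omega)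
  rw [v20, v21] at e1
  have f4 : s2 4 = s 4 := by rw [hf2 4 (by decide), hf1 4 (by decide)]
  have f6 : s2 6 = s 6 := by rw [hf2 6 (by decide), hf1 6 (by decide)]
  have f10 : s2 10 = s 10 := by rw [hf2 10 (by decide), hf1 10 (by decide)]
  have f11 : s2 11 = s 11 := by rw [hf2 11 (by decide), hf1 11 (by decide)]
  have hw : ∀ x, (write 12 (ix (var 20) (var 21)) (.lit 1)).den s2 12 x =
      if x = v * n + c then 1 else s2 12 x := by
    intro x
    rw [den_write, e1, Mem.set_self, Function.update_apply]
    rfl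
  have hwr : Q v c → ((write 12 (ix (var 20) (var 21)) (.lit 1)).den s2 12 (u * n + d) ≠ 0 ↔
      (u < v ∨ u = v ∧ d < c + 1) ∧ Q u d) := by
    intro hQ
    rw [hw]
    split_ifs with h
    · obtain ⟨rfl, rfl⟩ := index_inj hd (by omega) h
      exact iff_of_true one_ne_zero ⟨Or.inr ⟨rfl, by omega⟩, hQ⟩
    · have hne : ¬ (u = v ∧ d = c) := fun h' => h (by rw [h'.1, h'.2])
      refine (hI2 u hu d hd).trans (and_congr_left fun _ => ?_)
      omega
  have hno : ¬ Q v c → (s2 12 (u * n + d) ≠ 0 ↔ (u < v ∨ u = v ∧ d < c + 1) ∧ Q u d) := by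
    intro hQ
    refine (hI2 u hu d hd).trans (and_congr_left fun hQ' => ?_)
    have hne : ¬ (u = v ∧ d = c) := fun h' => hQ (h'.1 ▸ h'.2 ▸ hQ')
    omega
  rw [Mem.set_of_ne _ _ _ (by decide), den]
  split_ifs with hcond
  · rw [Expr.eval, Expr.eval, e1, f6, Expr.eval, Expr.eval, f11] at hcond
    exact hwr (Or.inl (by omega))
  · rw [Expr.eval, Expr.eval, e1, f6, Expr.eval, Expr.eval, f11] at hcond
    rw [den_whenAll]
    split_ifs with hc2 <;> simp only [tests_cons, tests_nil, and_true, eval_eqE, Expr.eval, e20,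
      h21, f10, f4] at hc2
    · exact hwr (Or.inr hc2)
    · exact hno (not_or.2 ⟨by omega, hc2⟩)

/-! ### Writing the splits to the output bank -/

/-- The word `w` has been written to the output bank; the position is in bank `13`. -/
def Written (s : Mem) (w : List ℕ) : Prop := s 13 0 = w.length ∧ s.Outputs w

theorem Written.congr {s s' : Mem} {w : List ℕ} (h : Written s w) (h1 : s' 1 = s 1)
    (h13 : s' 13 = s 13) : Written s' w := by
  refine ⟨by rw [h13, h.1], fun i hi => ?_⟩
  rw [h1, h.2 i hi]

def emit (e : Expr) : Cmd := seq (write 1 (var 13) e) (write 13 (.lit 0) (.add (var 13) (.lit 1)))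

theorem Written.emit {s : Mem} {w : List ℕ} (h : Written s w) (e : Expr) :
    Written ((emit e).den s) (w ++ [e.eval s]) := by
  have e13 : (var 13).eval s = w.length := h.1
  simp only [PVS.emit, den_seq, den_write, e13]
  refine ⟨?_, fun i hi => ?_⟩
  · simp [Mem.set_self, Mem.set_of_ne, Expr.eval, h.1]
  · rw [Mem.set_of_ne _ _ _ (by decide), Mem.set_self, Function.update_apply]
    split_ifs with h'
    · subst h'
      simp
    · have hi' : i < w.length := by simp at hi; omega
      rw [h.2 i hi', List.getElem_append_left hi']

theorem Written.rep {b k : ℕ} {c : Cmd} {s : Mem} {w : List ℕ} {f : ℕ → List ℕ} (hb : 20 ≤ b)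
    (hstep : ∀ i s' w, i < s 0 0 + k → (∀ b' ∉ (rep b k c).banks, s' b' = s b') → s' b 0 = i →
      Written s' w → Written (c.den s') (w ++ f i)) (h : Written s w) :
    Written ((Cmd.rep b k c).den s) (w ++ (List.range (s 0 0 + k)).flatMap f) := by
  refine rep_induction (fun i s' => Written s' (w ++ (List.range i).flatMap f)) ?_ ?_
  · simpa using h.congr (Mem.set_of_ne _ _ _ (by omega)) (Mem.set_of_ne _ _ _ (by omega))
  · intro i s' hi hf hb' hI
    have := hstep i s' _ hi hf hb' hI
    rw [List.range_succ, List.flatMap_append, List.flatMap_singleton, ← List.append_assoc]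
    exact this.congr (Mem.set_of_ne _ _ _ (by omega)) (Mem.set_of_ne _ _ _ (by omega))

/-- The data from which the output is computed. -/
structure OutputState {n : ℕ} (G : CorrelationGraph n) (rp S X : ℕ → ℕ) (s : Mem) : Prop where
  base : Base G s
  rp_eq : s 4 = rp
  S_eq : s 10 = S
  X_eq : s 12 = X

section

variable {n : ℕ} {G : CorrelationGraph n} {rp S X : ℕ → ℕ} {s s' : Mem} {v c : ℕ} {w : List ℕ}

theorem OutputState.congr (h : OutputState G rp S X s)
    (hf : ∀ b ∈ [0, 2, 4, 10, 12], s' b = s b) : OutputState G rp S X s' :=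
  ⟨h.base.congr (hf 0 (by decide)) (hf 2 (by decide)), by rw [hf 4 (by decide), h.rp_eq],
    by rw [hf 10 (by decide), h.S_eq], by rw [hf 12 (by decide), h.X_eq]⟩

theorem flatMap_range_mul (m n : ℕ) (f : ℕ → List ℕ) :
    (List.range (m * n)).flatMap f =
      (List.range m).flatMap fun i => (List.range n).flatMap fun j => f (i * n + j) := by
  induction m with
  | zero => simp
  | succ m ih =>
    rw [add_mul, one_mul, List.range_add, List.flatMap_append, ih, List.range_succ,
      List.flatMap_append, List.flatMap_map]
    simp

open Classical in
/-- The entry for the vertices `v` and `b < n` after `v` has been split for the cluster `c`. -/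
noncomputable def colourOld (G : CorrelationGraph n) (rp S : ℕ → ℕ) (v c b : ℕ) : ℕ :=
  if b = v then 0 else if S b ≠ 0 then 1 else if G.bl v b ∧ c < rp b then 1 else 2

/-- The entry for a copy in the cluster `c` and the vertex `b < n`. -/
def colourNew (rp S : ℕ → ℕ) (c b : ℕ) : ℕ :=
  if S b ≠ 0 then 2 else if rp b = c then 1 else 2

/-- The entries for the copies that were created for the pairs before `q`. -/
def copies (n : ℕ) (X : ℕ → ℕ) (q : ℕ) (f : ℕ → ℕ) : List ℕ :=
  (List.range (n * n)).flatMap fun q' => if X q' ≠ 0 ∧ q' < q then [f (q' % n)] else []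

def rowOldCmd : Cmd :=
  rep 22 0 (ite (eqE (var 22) (var 20)) (emit (.lit 0)) (ite (.read 10 (var 22)) (emit (.lit 1))
    (ite (adj (var 20) (var 22)) (ite (.sub (.read 4 (var 22)) (var 21)) (emit (.lit 1))
      (emit (.lit 2))) (emit (.lit 2)))))

theorem rowOldCmd_spec (h : OutputState G rp S X s) (h20 : s 20 0 = v) (h21 : s 21 0 = c)
    (hv : v < n) (hw : Written s w) :
    Written (rowOldCmd.den s) (w ++ (List.range n).map (colourOld G rp S v c)) := by
  have key := Written.rep (b := 22) (k := 0) (s := s) (w := w)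
    (f := fun b => [colourOld G rp S v c b])
    (c := ite (eqE (var 22) (var 20)) (emit (.lit 0)) (ite (.read 10 (var 22)) (emit (.lit 1))
    (ite (adj (var 20) (var 22)) (ite (.sub (.read 4 (var 22)) (var 21)) (emit (.lit 1))
      (emit (.lit 2))) (emit (.lit 2))))) (by decide) ?_ hw
  · rw [h.base.size] at key
    rw [List.map_eq_flatMap]
    exact key
  intro b s1 w1 hb hf h22 hw1
  rw [h.base.size] at hb
  have h1 : OutputState G rp S X s1 := h.congr fun b hb => hf b (by
    simp only [List.mem_cons, List.not_mem_nil, or_false] at hb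
    rcases hb with rfl | rfl | rfl | rfl | rfl <;> decide)
  have e20 : s1 20 0 = v := by rw [hf 20 (by decide), h20]
  have e21 : s1 21 0 = c := by rw [hf 21 (by decide), h21]
  have v20 : (var 20).eval s1 = v := e20
  have v22 : (var 22).eval s1 = b := h22
  have a1 := h1.base.eval_adj (x := var 20) (y := var 22) (by omega) (by omega)
  have r10 : (Expr.read 10 (var 22)).eval s1 = S b := by rw [Expr.eval, v22, h1.S_eq]
  have r4 : (Expr.sub (.read 4 (var 22)) (var 21)).eval s1 = rp b - c := by
    simp [Expr.eval, h22, h1.rp_eq, e21]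
  simp only [den]
  unfold colourOld
  by_cases c1 : b = v
  · rw [if_pos (eval_eqE.2 (by rw [v22, v20, c1])), if_pos c1]
    exact hw1.emit _
  · rw [if_neg (fun h => c1 (by rw [← v22, ← v20, eval_eqE.1 h])), if_neg c1, r10]
    by_cases c2 : S b = 0
    · rw [if_neg (not_not.2 c2), if_neg (not_not.2 c2), r4]
      by_cases c3 : G.bl v b
      · rw [if_pos (a1.2 (by rwa [v20, v22]))]
        by_cases c4 : c < rp b
        · rw [if_pos (by omega), if_pos ⟨c3, c4⟩]
          exact hw1.emit _
        · rw [if_neg (by omega), if_neg fun h => c4 h.2]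
          exact hw1.emit _
      · rw [if_neg (fun h => c3 (by rw [← v20, ← v22]; exact a1.1 h)), if_neg fun h => c3 h.1]
        exact hw1.emit _
    · rw [if_pos c2, if_pos c2]
      exact hw1.emit _

def rowNewCmd : Cmd :=
  rep 22 0 (ite (.read 10 (var 22)) (emit (.lit 2)) (ite (eqE (.read 4 (var 22)) (var 21))
    (emit (.lit 1)) (emit (.lit 2))))

theorem rowNewCmd_spec (h : OutputState G rp S X s) (h21 : s 21 0 = c) (hw : Written s w) :
    Written (rowNewCmd.den s) (w ++ (List.range n).map (colourNew rp S c)) := by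
  have key := Written.rep (b := 22) (k := 0) (s := s) (w := w)
    (f := fun b => [colourNew rp S c b])
    (c := ite (.read 10 (var 22)) (emit (.lit 2)) (ite (eqE (.read 4 (var 22)) (var 21))
    (emit (.lit 1)) (emit (.lit 2)))) (by decide) ?_ hw
  · rw [h.base.size] at key
    rw [List.map_eq_flatMap]
    exact key
  intro b s1 w1 hb hf h22 hw1
  have e21 : (var 21).eval s1 = c := by rw [Expr.eval, Expr.eval, hf 21 (by decide), h21]
  have r10 : (Expr.read 10 (var 22)).eval s1 = S b := by
    rw [Expr.eval, Expr.eval, Expr.eval, h22, hf 10 (by decide), h.S_eq]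
  have r4 : (Expr.read 4 (var 22)).eval s1 = rp b := by
    rw [Expr.eval, Expr.eval, Expr.eval, h22, hf 4 (by decide), h.rp_eq]
  simp only [den, r10, eval_eqE, r4, e21, colourNew]
  split_ifs <;> exact hw1.emit _

/-- Copies are created in increasing order of their pairs, so those already present belong to the
chosen pairs before the current one. While `d` runs, bank 23 holds the cluster of the copy. -/
def copiesCmd (d : Cmd) : Cmd :=
  rep 22 0 (rep 23 0 (whenAll [.read 12 (ix (var 22) (var 23)),
    .sub (ix (var 20) (var 21)) (ix (var 22) (var 23))] d))

theorem copiesCmd_spec {d : Cmd} {f : ℕ → ℕ} (h : OutputState G rp S X s) (h20 : s 20 0 = v)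
    (h21 : s 21 0 = c) (hv : v < n) (hw : Written s w)
    (hbanks : ∀ b ∈ d.banks, b = 1 ∨ b = 13)
    (hd : ∀ s' w j, s' 21 0 = c → s' 23 0 = j → Written s' w → Written (d.den s') (w ++ [f j])) :
    Written ((copiesCmd d).den s) (w ++ copies n X (v * n + c) f) := by
  have hfr : ∀ {s s' : Mem} {l : List ℕ}, (∀ b ∈ l, 20 < b ∧ b ≠ 21) →
      (∀ b' ∉ l ++ d.banks, s' b' = s b') → ∀ b ∈ [0, 2, 4, 10, 12, 20, 21], s' b = s b := by
    intro s s' l hl hf b hb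
    refine hf b fun h' => ?_
    simp only [List.mem_cons, List.not_mem_nil, or_false] at hb
    rcases List.mem_append.1 h' with h' | h'
    · have := hl b h'
      omega
    · have := hbanks b h'
      omega
  have e1 : copies n X (v * n + c) f = (List.range n).flatMap fun i =>
      (List.range n).flatMap fun j =>
        if X (i * n + j) ≠ 0 ∧ i * n + j < v * n + c then [f j] else [] := by
    rw [copies, flatMap_range_mul]
    refine List.flatMap_congr fun i _ => List.flatMap_congr fun j hj => ?_
    rw [Nat.mul_add_mod_self_right, Nat.mod_eq_of_lt (List.mem_range.1 hj)]
  have key := Written.rep (b := 22) (k := 0) (s := s) (w := w)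
    (f := fun i => (List.range n).flatMap fun j =>
        if X (i * n + j) ≠ 0 ∧ i * n + j < v * n + c then [f j] else [])
    (c := rep 23 0 (whenAll [.read 12 (ix (var 22) (var 23)),
    .sub (ix (var 20) (var 21)) (ix (var 22) (var 23))] d)) (by decide) ?_ hw
  · rw [e1]
    rw [h.base.size] at key
    exact key
  intro i s1 w1 hi hf1 h22 hw1
  rw [h.base.size] at hi
  have hf1' := hfr (s := s) (s' := s1) (l := [22, 23]) (by decide) (fun b hb => hf1 b (by
    simpa [banks, whenAll] using hb))
  have h1 : OutputState G rp S X s1 := h.congr fun b hb => hf1' b (by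
    revert b; decide)
  have key := Written.rep (b := 23) (k := 0) (s := s1) (w := w1)
    (f := fun j => if X (i * n + j) ≠ 0 ∧ i * n + j < v * n + c then [f j] else [])
    (c := whenAll [.read 12 (ix (var 22) (var 23)),
    .sub (ix (var 20) (var 21)) (ix (var 22) (var 23))] d) (by decide) ?_ hw1
  · rw [h1.base.size] at key
    exact key
  intro j s2 w2 hj hf2 h23 hw2
  have hf2' := hfr (s := s1) (s' := s2) (l := [23]) (by decide) (fun b hb => hf2 b (by
    simpa [banks, whenAll] using hb))
  have h2 : OutputState G rp S X s2 := h1.congr fun b hb => hf2' b (by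
    revert b; decide)
  have e22 : s2 22 0 = i := by
    rw [hf2 22 ?_, h22]
    intro h'
    simp only [banks, whenAll, List.mem_cons, List.mem_append, List.not_mem_nil] at h'
    have := hbanks 22
    tauto
  have e20 : s2 20 0 = v := by rw [hf2' 20 (by decide), hf1' 20 (by decide), h20]
  have e21 : s2 21 0 = c := by rw [hf2' 21 (by decide), hf1' 21 (by decide), h21]
  have v20 : (var 20).eval s2 = v := e20
  have v21 : (var 21).eval s2 = c := e21
  have v22 : (var 22).eval s2 = i := e22
  have v23 : (var 23).eval s2 = j := h23
  have a1 := h2.base.eval_ix (x := var 20) (y := var 21) (by omega)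
  have a2 := h2.base.eval_ix (x := var 22) (y := var 23) (by omega)
  rw [v20, v21] at a1
  rw [v22, v23] at a2
  have t : Tests s2 [.read 12 (ix (var 22) (var 23)),
      .sub (ix (var 20) (var 21)) (ix (var 22) (var 23))] ↔
      X (i * n + j) ≠ 0 ∧ i * n + j < v * n + c := by
    rw [tests_cons, tests_cons, tests_nil, and_true, Expr.eval, Expr.eval, a1, a2, h2.X_eq]
    omega
  rw [den_whenAll]
  by_cases hc : X (i * n + j) ≠ 0 ∧ i * n + j < v * n + c
  · rw [if_pos (t.2 hc), if_pos hc]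
    exact hd s2 w2 j e21 h23 hw2
  · rw [if_neg (fun h => hc (t.1 h)), if_neg hc, List.append_nil]
    exact hw2

/-- Writes the split for the pair in the banks `20` and `21`. -/
def stepCmd : Cmd :=
  seqs [emit (var 20), rowOldCmd, copiesCmd (emit (.lit 2)), emit (.lit 2), rowNewCmd,
    copiesCmd (ite (eqE (var 23) (var 21)) (emit (.lit 1)) (emit (.lit 2))), emit (.lit 0)]

/-- The original is red to all earlier copies. The final `2` and `0` are the entries of the new copy
against the original and against itself. -/
noncomputable def stepOut (G : CorrelationGraph n) (rp S X : ℕ → ℕ) (v c : ℕ) : List ℕ :=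
  v :: ((List.range n).map (colourOld G rp S v c) ++ copies n X (v * n + c) (fun _ => 2) ++ [2] ++
    ((List.range n).map (colourNew rp S c) ++
      copies n X (v * n + c) (fun j => if j = c then 1 else 2) ++ [0]))

theorem stepCmd_spec (h : OutputState G rp S X s) (h20 : s 20 0 = v) (h21 : s 21 0 = c)
    (hv : v < n) (hw : Written s w) :
    Written (stepCmd.den s) (w ++ stepOut G rp S X v c) := by
  have step : ∀ {s : Mem} (d : Cmd), (∀ b ∈ [0, 2, 4, 10, 12, 20, 21], b ∉ d.banks) →
      OutputState G rp S X s ∧ s 20 0 = v ∧ s 21 0 = c →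
      OutputState G rp S X (d.den s) ∧ d.den s 20 0 = v ∧ d.den s 21 0 = c := by
    rintro s d hd ⟨h1, h2, h3⟩
    refine ⟨h1.congr fun b hb => den_frame _ _ _ (hd b (by revert b; decide)), ?_, ?_⟩
    · rw [den_frame _ _ _ (hd 20 (by decide)), h2]
    · rw [den_frame _ _ _ (hd 21 (by decide)), h3]
  have h0 := And.intro h (And.intro h20 h21)
  simp only [stepCmd, seqs, den_seq]
  have w1 := hw.emit (var 20)
  have h1 := step (emit (var 20)) (by decide) h0
  have w2 := rowOldCmd_spec h1.1 h1.2.1 h1.2.2 hv w1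
  have h2 := step rowOldCmd (by decide) h1
  have w3 := copiesCmd_spec (d := emit (.lit 2)) (f := fun _ => 2) h2.1 h2.2.1 h2.2.2 hv w2
    (by decide) (fun s' w j _ _ hw' => hw'.emit _)
  have h3 := step (copiesCmd (emit (.lit 2))) (by decide) h2
  have w4 := w3.emit (.lit 2)
  have h4 := step (emit (.lit 2)) (by decide) h3
  have w5 := rowNewCmd_spec h4.1 h4.2.2 w4
  have h5 := step rowNewCmd (by decide) h4
  have w6 := copiesCmd_spec (d := ite (eqE (var 23) (var 21)) (emit (.lit 1)) (emit (.lit 2)))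
    (f := fun j => if j = c then 1 else 2) h5.1 h5.2.1 h5.2.2 hv w5
    (by decide) (fun s' w j e21 e23 hw' => by
      have v21 : (var 21).eval s' = c := e21
      have v23 : (var 23).eval s' = j := e23
      simp only [den, eval_eqE, v21, v23]
      split_ifs <;> exact hw'.emit _)
  have w7 := w6.emit (.lit 0)
  have e20 : (var 20).eval s = v := h20
  rw [e20] at w7
  simpa [stepOut, Expr.eval] using w7

/-- Counts the splits. -/
def countCmd : Cmd :=
  rep 20 0 (rep 21 0 (whenAll [.read 12 (ix (var 20) (var 21))]
    (write 16 (.lit 0) (.add (var 16) (.lit 1)))))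

theorem countCmd_spec (h : OutputState G rp S X s) (h16 : s 16 0 = 0) :
    countCmd.den s 16 0 = ((List.range (n * n)).filter (X · ≠ 0)).length := by
  have key := rep_induction (b := 20) (k := 0) (s := s) (c := rep 21 0
    (whenAll [.read 12 (ix (var 20) (var 21))] (write 16 (.lit 0) (.add (var 16) (.lit 1)))))
    (fun i s' => s' 16 0 = ((List.range (i * n)).filter (X · ≠ 0)).length)
    (by simp [Mem.set_of_ne, h16]) ?_
  · rw [h.base.size] at key
    exact key
  intro v s1 hv hf1 h20 hI
  have hB1 := h.base.congr (hf1 0 (by decide)) (hf1 2 (by decide))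
  rw [h.base.size] at hv
  have key := rep_induction (b := 21) (k := 0) (s := s1) (c :=
    whenAll [.read 12 (ix (var 20) (var 21))] (write 16 (.lit 0) (.add (var 16) (.lit 1))))
    (fun j s' => s' 16 0 = ((List.range (v * n + j)).filter (X · ≠ 0)).length)
    (by simpa [Mem.set_of_ne] using hI) ?_
  · rw [hB1.size] at key
    rw [Mem.set_of_ne _ _ _ (by decide), add_mul, one_mul]
    exact key
  intro c s2 hc hf2 h21 hI
  have hB2 := hB1.congr (hf2 0 (by decide)) (hf2 2 (by decide))
  have v20 : (var 20).eval s2 = v := by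
    rw [Expr.eval, Expr.eval, hf2 20 (by decide), h20]
  have v21 : (var 21).eval s2 = c := h21
  have e1 := hB2.eval_ix (x := var 20) (y := var 21) (by omega)
  have e12 : s2 12 = X := by rw [hf2 12 (by decide), hf1 12 (by decide), h.X_eq]
  rw [den_whenAll, Mem.set_of_ne _ _ _ (show 16 ≠ 21 by decide), ← add_assoc, List.range_succ,
    List.filter_append, List.length_append]
  split_ifs with hcond <;> rw [tests_cons, tests_nil, and_true, Expr.eval, e1, v20, v21, e12]
    at hcond
  · simp [den, Expr.eval, Mem.set_self, hI, hcond]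
  · rw [hI]
    simp [not_not.1 hcond]

/-- Writes the output. -/
def outputCmd : Cmd :=
  seqs [countCmd, emit (var 16),
    rep 20 0 (rep 21 0 (whenAll [.read 12 (ix (var 20) (var 21))] stepCmd))]

theorem outputCmd_spec (h : OutputState G rp S X s) (h16 : s 16 0 = 0) (h13 : s 13 0 = 0) :
    (outputCmd.den s).Outputs (((List.range (n * n)).filter (X · ≠ 0)).length ::
      ((List.range (n * n)).filter (X · ≠ 0)).flatMap fun q =>
        stepOut G rp S X (q / n) (q % n)) := by
  have hf : ∀ b ∉ countCmd.banks, countCmd.den s b = s b := fun b => den_frame _ _ _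
  have w0 : Written (countCmd.den s) [] := ⟨by rw [hf 13 (by decide), h13]; rfl, by
    intro i hi; simp at hi⟩
  have w1 := w0.emit (var 16)
  have e16 : (var 16).eval (countCmd.den s) = _ := countCmd_spec h h16
  rw [e16] at w1
  simp only [outputCmd, seqs, den_seq]
  set s1 := (emit (var 16)).den (countCmd.den s) with hs1
  have h1 : OutputState G rp S X s1 := h.congr fun b hb => by
    rw [hs1, den_frame _ _ _ (by revert b; decide), hf b (by revert b; decide)]
  have e1 : (((List.range (n * n)).filter (X · ≠ 0)).flatMap fun q =>
        stepOut G rp S X (q / n) (q % n)) = (List.range n).flatMap fun v =>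
          (List.range n).flatMap fun c => if X (v * n + c) ≠ 0 then stepOut G rp S X v c else [] := by
    have : ∀ (l : List ℕ) (f : ℕ → List ℕ), (l.filter (X · ≠ 0)).flatMap f =
        l.flatMap fun q => if X q ≠ 0 then f q else [] := by
      intro l f
      induction l with
      | nil => rfl
      | cons a l ih => by_cases ha : X a = 0 <;> simp_all
    rw [this, flatMap_range_mul]
    refine List.flatMap_congr fun i _ => List.flatMap_congr fun j hj => ?_
    have hj := List.mem_range.1 hj
    rw [Nat.mul_add_mod_self_right, Nat.mod_eq_of_lt hj, Nat.add_comm, Nat.add_mul_div_right _ _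
      (by omega), Nat.div_eq_of_lt hj, Nat.zero_add]
  have key := Written.rep (b := 20) (k := 0) (s := s1) (c := rep 21 0
    (whenAll [.read 12 (ix (var 20) (var 21))] stepCmd))
    (f := fun v => (List.range n).flatMap fun c =>
      if X (v * n + c) ≠ 0 then stepOut G rp S X v c else []) (by decide) ?_ w1
  · rw [h1.base.size] at key
    rw [e1]
    exact key.2
  intro v s2 w2 hv hf2 h20 hw2
  have h2 : OutputState G rp S X s2 := h1.congr fun b hb => hf2 b (by revert b; decide)
  rw [h1.base.size] at hv
  have key := Written.rep (b := 21) (k := 0) (s := s2) (c :=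
    whenAll [.read 12 (ix (var 20) (var 21))] stepCmd)
    (f := fun c => if X (v * n + c) ≠ 0 then stepOut G rp S X v c else []) (by decide) ?_ hw2
  · rw [h2.base.size] at key
    exact key
  intro c s3 w3 hc hf3 h21 hw3
  have h3 : OutputState G rp S X s3 := h2.congr fun b hb => hf3 b (by revert b; decide)
  have e20 : s3 20 0 = v := by rw [hf3 20 (by decide), h20]
  have v20 : (var 20).eval s3 = v := e20
  have v21 : (var 21).eval s3 = c := h21
  have e1 := h3.base.eval_ix (x := var 20) (y := var 21) (by omega)
  have t : Tests s3 [.read 12 (ix (var 20) (var 21))] ↔ X (v * n + c) ≠ 0 := by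
    rw [tests_cons, tests_nil, and_true, Expr.eval, e1, v20, v21, h3.X_eq]
  rw [den_whenAll]
  by_cases hX : X (v * n + c) ≠ 0
  · rw [if_pos (t.2 hX), if_pos hX]
    exact stepCmd_spec h3 e20 h21 hv hw3
  · rw [if_neg (fun h => hX (t.1 h)), if_neg hX, List.append_nil]
    exact hw3

end

/-! ### The output encodes a valid sequence of splits -/

/-- Because the list of pairs is increasing, the pairs before the `k`-th one are exactly those of
the first `k` splits. -/
theorem filter_lt_getElem (l : List ℕ) (hl : l.Pairwise (· < ·)) (k : ℕ) (hk : k < l.length) :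
    l.filter (· < l[k]) = l.take k := by
  induction l generalizing k with
  | nil => simp at hk
  | cons a l ih =>
    rw [List.pairwise_cons] at hl
    cases k with
    | zero => simpa using fun b hb => (hl.1 b hb).le
    | succ k =>
      have hk' : k < l.length := by simpa using hk
      rw [List.take_succ_cons, ← ih hl.2 k hk', List.getElem_cons_succ]
      exact List.filter_cons_of_pos (by simpa using hl.1 _ (List.getElem_mem hk'))

/-- The conditions under which the pairs in `X` describe a plan. -/
structure PairData {n : ℕ} (G : CorrelationGraph n) (rp S X : ℕ → ℕ) : Prop where
  rp_lt : ∀ a < n, rp a < n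
  mem : ∀ v < n, ∀ c < n, X (v * n + c) ≠ 0 → S v ≠ 0
  self : ∀ v < n, S v ≠ 0 → X (v * n + rp v) ≠ 0
  rep_iff : ∀ a < n, ∀ b < n, S a = 0 → S b = 0 → a ≠ b → (G.bl a b ↔ rp a = rp b)
  cover : ∀ s u, S s ≠ 0 → S u = 0 → G.bl s u → X (s * n + rp u) ≠ 0

namespace PairData

variable {n : ℕ} {G : CorrelationGraph n} {rp S X : ℕ → ℕ}

/-- The positions of the pairs. -/
def positions (n : ℕ) (X : ℕ → ℕ) : List ℕ := (List.range (n * n)).filter (X · ≠ 0)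

theorem mem_positions {q : ℕ} : q ∈ positions n X ↔ q < n * n ∧ X q ≠ 0 := by
  simp [positions]

theorem pairwise_positions : (positions n X).Pairwise (· < ·) :=
  List.Pairwise.filter _ List.pairwise_lt_range

theorem exists_position {v c : ℕ} (hv : v < n) (hc : c < n) (h : X (v * n + c) ≠ 0) :
    ∃ k, ∃ hk : k < (positions n X).length, (positions n X)[k] = v * n + c :=
  List.mem_iff_getElem.1 (mem_positions.2 ⟨index_lt hv hc, h⟩)

theorem getD_positions {k : ℕ} (hk : k < (positions n X).length) :
    (positions n X).getD k 0 = (positions n X)[k] := by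
  rw [List.getD_eq_getElem?_getD, List.getElem?_eq_getElem hk]
  rfl

theorem position_spec {k : ℕ} (hk : k < (positions n X).length) :
    (positions n X)[k] / n < n ∧ (positions n X)[k] % n < n ∧
      X ((positions n X)[k] / n * n + (positions n X)[k] % n) ≠ 0 := by
  obtain ⟨h1, h2⟩ := mem_positions.1 (List.getElem_mem hk)
  have hn : 0 < n := Nat.pos_of_ne_zero fun h => by simp [h] at h1
  exact ⟨Nat.div_lt_of_lt_mul h1, Nat.mod_lt _ hn, by rwa [Nat.div_add_mod']⟩

theorem div_mod_index {v c : ℕ} (hc : c < n) : (v * n + c) / n = v ∧ (v * n + c) % n = c := by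
  constructor
  · rw [Nat.add_comm, Nat.add_mul_div_right _ _ (by omega), Nat.div_eq_of_lt hc, Nat.zero_add]
  · rw [Nat.mul_add_mod_self_right, Nat.mod_eq_of_lt hc]

/-- The plan that splits in the order of the positions. -/
def plan (h : PairData G rp S X) : SplitPlan G where
  S := fun a => S a ≠ 0
  rep := rp
  v := fun k => (positions n X).getD k 0 / n
  c := fun k => (positions n X).getD k 0 % n
  len := (positions n X).length
  v_lt := fun k hk => by
    rw [getD_positions hk]
    exact (position_spec hk).1
  v_mem := fun k hk => by
    rw [getD_positions hk]
    obtain ⟨h1, h2, h3⟩ := position_spec hk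
    exact h.mem _ h1 _ h2 h3
  mem_v := fun s hs hS => by
    obtain ⟨k, hk, h1⟩ := exists_position hs (h.rp_lt s hs) (h.self s hs hS)
    exact ⟨k, hk, by rw [getD_positions hk, h1, (div_mod_index (h.rp_lt s hs)).1]⟩
  rep_iff := fun a ha b hb hSa hSb => h.rep_iff a ha b hb (not_not.1 hSa) (not_not.1 hSb)
  cover := fun s u hs hu hsu => by
    have hr := h.rp_lt u hsu.2.1
    obtain ⟨k, hk, h1⟩ := exists_position hsu.1 hr (h.cover s u hs (not_not.1 hu) hsu)
    exact ⟨k, hk, by rw [getD_positions hk, h1, (div_mod_index hr).1],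
      by rw [getD_positions hk, h1, (div_mod_index hr).2]⟩

theorem copies_eq {k : ℕ} (hk : k < (positions n X).length) (f : ℕ → ℕ) :
    copies n X (positions n X)[k] f =
      (List.range k).map fun l => f ((positions n X).getD l 0 % n) := by
  have h1 : copies n X (positions n X)[k] f =
      ((positions n X).filter (· < (positions n X)[k])).map fun q => f (q % n) := by
    have : ∀ (l : List ℕ) (q : ℕ), (l.flatMap fun q' => if X q' ≠ 0 ∧ q' < q then [f (q' % n)] else [])
        = ((l.filter (X · ≠ 0)).filter (· < q)).map fun q => f (q % n) := by
      intro l q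
      induction l with
      | nil => rfl
      | cons a l ih => by_cases ha : X a = 0 <;> by_cases hq : a < q <;> simp_all
    exact this _ _
  rw [h1, filter_lt_getElem _ pairwise_positions k hk]
  refine List.ext_getElem (by simp; omega) fun i hi hi' => ?_
  have hik : i < k := by simpa using hi'
  simp only [List.getElem_map, List.getElem_take, List.getElem_range]
  rw [getD_positions (by omega)]

/-- The abstract stage depends on the history of splits, while the program sees only the current
pair. The two agree because the pairs are treated in increasing order. -/
theorem stepCode_plan (h : PairData G rp S X) {k : ℕ} (hk : k < (positions n X).length) :
    h.plan.stepCode k = stepOut G rp S X ((positions n X)[k] / n) ((positions n X)[k] % n) := by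
  have hv : h.plan.v k = (positions n X)[k] / n := by
    change (positions n X).getD k 0 / n = _
    rw [getD_positions hk]
  have hc : h.plan.c k = (positions n X)[k] % n := by
    change (positions n X).getD k 0 % n = _
    rw [getD_positions hk]
  obtain ⟨hvn, hcn, hX⟩ := position_spec hk
  have hSv : S ((positions n X)[k] / n) ≠ 0 := h.mem _ hvn _ hcn hX
  set v := (positions n X)[k] / n with hvdef
  set c := (positions n X)[k] % n with hcdef
  have hq : v * n + c = (positions n X)[k] := Nat.div_add_mod' _ _
  have hproc : h.plan.Processed (k + 1) v := ⟨k, by omega, hv⟩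
  -- The splits of `v` run through its clusters in increasing order, and by `cover` the cluster of
  -- `b` is among them. So the edge has been moved exactly when `rp b ≤ c`.
  have hmoved : ∀ b < n, G.bl v b → S b = 0 → (h.plan.Moved (k + 1) v (rp b) ↔ ¬ c < rp b) := by
    intro b hb hvb hSb
    have hr := h.rp_lt b hb
    obtain ⟨l, hl, h1⟩ := exists_position hvn hr (h.cover v b hSv hSb hvb)
    constructor
    · rintro ⟨l', hl', h2, h3⟩
      have hl'' : l' < (positions n X).length := by omega
      have h4 : (positions n X)[l'] = v * n + rp b := by
        rw [← getD_positions hl'', ← Nat.div_add_mod' ((positions n X).getD l' 0) n]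
        rw [show (positions n X).getD l' 0 / n = v from h2,
          show (positions n X).getD l' 0 % n = rp b from h3]
      have h5 : (positions n X)[l'] ≤ (positions n X)[k] := by
        rcases Nat.lt_succ_iff_lt_or_eq.1 hl' with h6 | rfl
        · exact (List.pairwise_iff_getElem.1 pairwise_positions l' k hl'' hk h6).le
        · rfl
      omega
    · intro h2
      refine ⟨l, ?_, ?_, ?_⟩
      · by_contra h3
        have := List.pairwise_iff_getElem.1 pairwise_positions k l hk hl (by omega)
        omega
      · change (positions n X).getD l 0 / n = v
        rw [getD_positions hl, h1, (div_mod_index hr).1]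
      · change (positions n X).getD l 0 % n = rp b
        rw [getD_positions hl, h1, (div_mod_index hr).2]
  have hSiff : ∀ a, h.plan.S a ↔ S a ≠ 0 := fun a => Iff.rfl
  have hrep : ∀ a, h.plan.rep a = rp a := fun a => rfl
  have A : ∀ b < n, h.plan.colour (k + 1) v b = colourOld G rp S v c b := by
    intro b hb
    unfold SplitPlan.colour colourOld
    by_cases hbv : b = v
    · rw [if_pos hbv.symm, if_pos hbv]
    · rw [if_neg (Ne.symm hbv), if_neg hbv, SplitPlan.Blue, if_pos hvn, if_pos hb,
        if_pos ((hSiff v).2 hSv)]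
      by_cases hSb : S b = 0
      · rw [if_neg (show ¬ h.plan.S b from not_not.2 hSb), if_neg (not_not.2 hSb), hrep]
        by_cases hvb : G.bl v b
        · simp only [hvb, true_and, hmoved b hb hvb hSb, not_not]
        · simp only [hvb, false_and]
      · rw [if_pos (show h.plan.S b from hSb), if_pos (show S b ≠ 0 from hSb),
          if_pos (Or.inr (Or.inl hproc))]
  have B : ∀ l, h.plan.colour (k + 1) v (n + l) = 2 := by
    intro l
    rw [SplitPlan.colour, if_neg (show ¬ v = n + l by omega), SplitPlan.Blue, if_pos hvn,
      if_neg (show ¬ n + l < n by omega), if_neg fun h' => h'.1 ((hSiff v).2 hSv)]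
  have C : ∀ b < n, h.plan.colour (k + 1) (n + k) b = colourNew rp S c b := by
    intro b hb
    rw [SplitPlan.colour, if_neg (show ¬ n + k = b by omega), SplitPlan.Blue,
      if_neg (show ¬ n + k < n by omega), if_pos hb, hrep,
      Nat.add_sub_cancel_left, hc, colourNew]
    by_cases hSb : S b = 0
    · simp [hSiff, hSb]
    · simp [hSiff, hSb]
  have E : ∀ l < k, h.plan.colour (k + 1) (n + k) (n + l) =
      if (positions n X).getD l 0 % n = c then 1 else 2 := by
    intro l hl
    rw [SplitPlan.colour, if_neg (show ¬ n + k = n + l by omega), SplitPlan.Blue,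
      if_neg (show ¬ n + k < n by omega), if_neg (show ¬ n + l < n by omega), Nat.add_sub_cancel_left, Nat.add_sub_cancel_left, hc]
    have e : h.plan.c l = (positions n X).getD l 0 % n := rfl
    rw [e]
    simp only [eq_comm]
  have F : h.plan.colour (k + 1) (n + k) (n + k) = 0 := if_pos rfl
  rw [SplitPlan.stepCode, stepOut, hv, hq, copies_eq hk, copies_eq hk, add_assoc, List.range_add,
    List.range_succ]
  simp only [List.map_append, List.map_map, List.map_cons, List.map_nil, F, B]
  rw [List.map_congr_left fun b hb => A b (List.mem_range.1 hb),
    List.map_congr_left fun b hb => C b (List.mem_range.1 hb)]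
  have e1 : List.map (h.plan.colour (k + 1) v ∘ fun x => n + x) (List.range k) =
      (List.range k).map fun _ => 2 := List.map_congr_left fun l _ => B l
  have e2 : List.map (h.plan.colour (k + 1) (n + k) ∘ fun x => n + x) (List.range k) =
      (List.range k).map fun l => if (positions n X).getD l 0 % n = c then 1 else 2 :=
    List.map_congr_left fun l hl => E l (List.mem_range.1 hl)
  rw [e1, e2]
  simp

theorem exists_splitSeq (h : PairData G rp S X) (hG : G.IsComplete) :
    ∃ (m : ℕ) (H : CorrelationGraph m) (σ : SplitSeq G H), σ.length = (positions n X).length ∧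
      σ.StaysComplete ∧ σ.Clusters ∧ σ.encode = (positions n X).length ::
        (positions n X).flatMap fun q => stepOut G rp S X (q / n) (q % n) := by
  obtain ⟨m, H, σ, h1, h2, h3, h4⟩ := h.plan.exists_splitSeq hG
  refine ⟨m, H, σ, h1, h2, h3, ?_⟩
  rw [h4]
  change (positions n X).length :: (List.range (positions n X).length).flatMap _ = _
  have e : positions n X =
      (List.range (positions n X).length).map fun k => (positions n X).getD k 0 := by
    refine List.ext_getElem (by simp) fun i hi _ => ?_
    rw [List.getElem_map, List.getElem_range, getD_positions hi]
  conv_rhs => rw [e, List.flatMap_map]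
  rw [List.length_map, List.length_range]
  congr 1
  refine List.flatMap_congr fun k hk => ?_
  have hk := List.mem_range.1 hk
  rw [h.stepCode_plan hk, getD_positions hk]

end PairData

/-! ### Size of the cover and the complete algorithm -/

/-- The vertex cover that is read off from the final prices is not larger than the matching. -/
theorem AuctionInv.card_cover_le {n : ℕ} {G : CorrelationGraph n} {mk rp : ℕ → ℕ}
    {p mate : ℕ → ℕ} (h : AuctionInv G mk rp ((n + 2) * (n + 2)) p mate)
    (hsat : ∀ a < n, Sated G mk rp ((n + 2) * (n + 2)) p mate a) {g : ℕ} (hg : IsGap n p g)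
    (T Q : Finset ℕ) (hT : ∀ a ∈ T, a < n ∧ InCover G mk rp p g a)
    (hQ : ∀ q ∈ Q, ∃ v < n, ∃ c < n, q = v * n + c ∧ g < p q) :
    T.card + Q.card ≤ ((Finset.range n).filter (mate · ≠ 0)).card := by
  classical
  set M := (Finset.range n).filter (mate · ≠ 0) with hM
  -- An unmatched sated vertex sees only prices of at least (n + 2)², hence above `g`, so it is not
  -- in the cover.
  have hTM : T ⊆ M := by
    intro a ha
    obtain ⟨han, hma, v, hv, hbl, hlt⟩ := hT a ha
    rw [hM, Finset.mem_filter, Finset.mem_range]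
    refine ⟨han, fun h0 => ?_⟩
    have h1 := hsat a han hma h0 v hv hbl
    have h2 := hg.2.1
    omega
  -- A price above `g` is positive, so the pair has an owner. If the owner were in `T`, it would see
  -- a price below `g`, and slack would bound its own price by `g`.
  have hQM : Q ⊆ (M \ T).image fun a => (mate a - 1) * n + rp a := by
    intro q hq
    obtain ⟨v, hv, c, hc, rfl, hlt⟩ := hQ q hq
    obtain ⟨a, ha, rfl⟩ := h.own v hv c hc (by omega)
    have han := (h.mate_spec a v ha).2.2.2.1
    refine Finset.mem_image.2 ⟨a, Finset.mem_sdiff.2 ⟨?_, fun haT => ?_⟩, by rw [ha]; rfl⟩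
    · rw [hM, Finset.mem_filter, Finset.mem_range]
      exact ⟨han, by omega⟩
    · obtain ⟨-, -, w, hw, hbl, hlt'⟩ := hT a haT
      have := h.slack a v w ha hw hbl
      omega
  have h1 := (Finset.card_le_card hQM).trans Finset.card_image_le
  have h2 := Finset.card_sdiff_of_subset hTM
  have h3 := Finset.card_le_card hTM
  omega

theorem getD_flatMap_range {m n : ℕ} (f : ℕ → ℕ → ℕ) {a b : ℕ} (ha : a < m) (hb : b < n) :
    ((List.range m).flatMap fun i => (List.range n).map (f i)).getD (a * n + b) 0 = f a b := by
  induction m with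
  | zero => omega
  | succ m ih =>
    have hl : ((List.range m).flatMap fun i => (List.range n).map (f i)).length = m * n := by
      simp [List.length_flatMap]
    rw [List.range_succ, List.flatMap_append, List.flatMap_singleton]
    rcases Nat.lt_succ_iff_lt_or_eq.1 ha with ha | rfl
    · rw [List.getD_append _ _ _ _ (by rw [hl]; nlinarith), ih ha]
    · rw [List.getD_append_right _ _ _ _ (by rw [hl]; omega), hl, Nat.add_sub_cancel_left]
      simp [hb]

theorem getD_encode {n : ℕ} (G : CorrelationGraph n) {a b : ℕ} (ha : a < n) (hb : b < n) :
    G.encode.getD (a * n + b + 1) 0 = 1 ↔ G.bl a b := by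
  classical
  have e : (List.ofFn G.row).flatten = (List.range n).flatMap fun a => (List.range n).map fun b =>
      if G.bl a b then 1 else if a = b then 0 else if ∃ (ha : a < n) (hb : b < n),
        G.red.Adj ⟨a, ha⟩ ⟨b, hb⟩ then 2 else 0 := by
    have e1 : List.ofFn G.row = (List.range n).map fun a => (List.range n).map fun b =>
      if G.bl a b then 1 else if a = b then 0 else if ∃ (ha : a < n) (hb : b < n),
        G.red.Adj ⟨a, ha⟩ ⟨b, hb⟩ then 2 else 0 := by
      refine List.ext_getElem (by simp) fun i hi hi' => ?_
      have hin : i < n := by simpa using hi'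
      rw [List.getElem_ofFn, List.getElem_map, List.getElem_range]
      refine List.ext_getElem (by simp [CorrelationGraph.row]) fun j hj hj' => ?_
      have hjn : j < n := by simpa using hj'
      rw [List.getElem_map, List.getElem_range]
      simp only [CorrelationGraph.row, List.getElem_ofFn, CorrelationGraph.bl, hin, hjn,
        exists_true_left]
      by_cases hij : i = j
      · subst hij
        simp
      · rw [if_neg hij]
    rw [e1]
    rfl
  rw [CorrelationGraph.encode, List.getD_cons_succ, e, getD_flatMap_range _ ha hb]
  split_ifs <;> simp_all

theorem base_init {n : ℕ} (G : CorrelationGraph n) :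
    Base G (tableCmd.den (Mem.init G.encode)) := by
  have hf : ∀ b ∉ tableCmd.banks, tableCmd.den (Mem.init G.encode) b = Mem.init G.encode b :=
    fun b => den_frame _ _ _
  refine ⟨?_, fun a ha b hb => ?_, fun a ha => ?_⟩
  · rw [hf 0 (by decide)]
    rfl
  · rw [hf 0 (by decide)]
    exact getD_encode G ha hb
  · exact tableCmd_spec _ rfl a (le_of_lt ha)

/-- The approximation algorithm. -/
def mainCmd : Cmd :=
  seqs [tableCmd, markCmd, repCmd, limitCmd, auctionCmd, gapCmd, splitSetCmd, pairsCmd, outputCmd]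

theorem mainCmd_spec {n : ℕ} (G : CorrelationGraph n) (hG : G.IsComplete) :
    ∃ (m : ℕ) (H : CorrelationGraph m) (σ : SplitSeq G H),
      (mainCmd.den (Mem.init G.encode)).Outputs σ.encode ∧ σ.StaysComplete ∧ σ.Clusters ∧
        ∀ (m' : ℕ) (H' : CorrelationGraph m') (τ : SplitSeq G H'),
          τ.Clusters → σ.length ≤ 7 * τ.length := by
  simp only [mainCmd, seqs, den_seq]
  have frame : ∀ (c : Cmd) (s : Mem), ∀ b ∉ c.banks, c.den s b = s b := den_frame
  have b1 := base_init G
  set s1 := tableCmd.den (Mem.init G.encode) with hs1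
  have f1 := frame tableCmd (Mem.init G.encode)
  rw [← hs1] at f1
  -- Zero memory serves as initial value throughout: no marks, no prices, no mates, no pairs, and
  -- counters at zero.
  have z1 : ∀ b ∉ [0, 2, 20], s1 b = fun _ => 0 := by
    intro b hb
    rw [f1 b (fun h => hb (by revert h; simp [tableCmd, banks]; tauto))]
    funext i
    exact if_neg fun h => hb (by simp [h])
  clear_value s1
  obtain ⟨hpack, hhit⟩ := markCmd_spec b1 (z1 3 (by decide))
  have f2 := frame markCmd s1
  set s2 := markCmd.den s1 with hs2
  clear_value s2
  have b2 : Base G s2 := b1.congr (f2 0 (by decide)) (f2 2 (by decide))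
  have hrep := repCmd_spec b2
  have f3 := frame repCmd s2
  set s3 := repCmd.den s2 with hs3
  clear_value s3
  have b3 : Base G s3 := b2.congr (f3 0 (by decide)) (f3 2 (by decide))
  have hN := limitCmd_spec (s := s3)
    (by rw [f3 5 (by decide), f2 5 (by decide), z1 5 (by decide)])
  rw [b3.size] at hN
  have f4 := frame limitCmd s3
  set s4 := limitCmd.den s3 with hs4
  clear_value s4
  have b4 : Base G s4 := b3.congr (f4 0 (by decide)) (f4 2 (by decide))
  have hrp : ∀ a < n, s3 4 a < n := fun a ha => (hrep a ha).le.trans_lt ha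
  have e6 : s4 6 = fun _ => 0 := by
    rw [f4 6 (by decide), f3 6 (by decide), f2 6 (by decide), z1 6 (by decide)]
  have e7 : s4 7 = fun _ => 0 := by
    rw [f4 7 (by decide), f3 7 (by decide), f2 7 (by decide), z1 7 (by decide)]
  have a4 : AuctionState G (s2 3) (s3 4) ((n + 2) * (n + 2)) s4 :=
    ⟨b4, by rw [f4 3 (by decide), f3 3 (by decide)], f4 4 (by decide), hN, by
      rw [e6, e7]
      constructor <;> simp⟩
  obtain ⟨a5, hsat⟩ := auctionCmd_spec a4 hrp
  have f5 := frame auctionCmd s4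
  set s5 := auctionCmd.den s4 with hs5
  clear_value s5
  have b5 := a5.base
  have hgap := gapCmd_spec b5 (by rw [f5 15 (by decide), f4 15 (by decide), f3 15 (by decide),
    f2 15 (by decide), z1 15 (by decide)])
  have f6 := frame gapCmd s5
  set s6 := gapCmd.den s5 with hs6
  clear_value s6
  have b6 : Base G s6 := b5.congr (f6 0 (by decide)) (f6 2 (by decide))
  have hS := splitSetCmd_spec b6
  rw [f6 3 (by decide), f6 4 (by decide), f6 6 (by decide), a5.mk_eq, a5.rp_eq] at hS
  have f7 := frame splitSetCmd s6
  set s7 := splitSetCmd.den s6 with hs7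
  clear_value s7
  have b7 : Base G s7 := b6.congr (f7 0 (by decide)) (f7 2 (by decide))
  have hX := pairsCmd_spec b7 (by rw [f7 12 (by decide), f6 12 (by decide), f5 12 (by decide),
    f4 12 (by decide), f3 12 (by decide), f2 12 (by decide), z1 12 (by decide)])
  rw [f7 11 (by decide), f7 6 (by decide), f6 6 (by decide), f7 4 (by decide), f6 4 (by decide),
    a5.rp_eq] at hX
  have f8 := frame pairsCmd s7
  set s8 := pairsCmd.den s7 with hs8
  clear_value s8
  have o8 : OutputState G (s3 4) (s7 10) (s8 12) s8 :=
    ⟨b7.congr (f8 0 (by decide)) (f8 2 (by decide)),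
      by rw [f8 4 (by decide), f7 4 (by decide), f6 4 (by decide), a5.rp_eq],
      f8 10 (by decide), rfl⟩
  have hout := outputCmd_spec o8
    (by rw [f8 16 (by decide), f7 16 (by decide), f6 16 (by decide), f5 16 (by decide),
      f4 16 (by decide), f3 16 (by decide), f2 16 (by decide), z1 16 (by decide)])
    (by rw [f8 13 (by decide), f7 13 (by decide), f6 13 (by decide), f5 13 (by decide),
      f4 13 (by decide), f3 13 (by decide), f2 13 (by decide), z1 13 (by decide)])
  set s9 := outputCmd.den s8 with hs9
  clear_value s9
  have hinv := a5.inv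
  generalize s2 3 = mk at *
  generalize s3 4 = rp at *
  generalize s5 6 = p at *
  generalize s5 7 = mate at *
  generalize s6 11 0 = g at *
  generalize s7 10 = S at *
  generalize s8 12 = X at *
  have hrepiff : ∀ a < n, ∀ b < n, mk a = 0 → mk b = 0 → a ≠ b → (G.bl a b ↔ rp a = rp b) :=
    fun a ha b hb ma mb hab => RepSpec.eq_iff hrep hhit ha hb ma mb hab
  have hS0 : ∀ a < n, S a = 0 → mk a = 0 ∧ ¬ InCover G mk rp p g a := by
    intro a ha h0
    have := not_congr (hS a ha)
    rw [not_not, not_or, not_not] at this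
    exact this.1 h0
  -- `pairsCmd` does not test whether the vertex of an expensive pair is marked; a positive price
  -- implies an owner, and this forces the mark.
  have hpm : ∀ v < n, ∀ c < n, g < p (v * n + c) → mk v ≠ 0 := by
    intro v hv c hc hlt
    obtain ⟨a, ha, -⟩ := hinv.own v hv c hc (by omega)
    exact (hinv.mate_spec a v ha).2.1
  have hD : PairData G rp S X := by
    refine ⟨hrp, fun v hv c hc h => ?_, fun v hv h => (hX v hv _ (hrp v hv)).2 (Or.inr ⟨h, rfl⟩),
      fun a ha b hb hSa hSb hab => hrepiff a ha b hb (hS0 a ha hSa).1 (hS0 b hb hSb).1 hab,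
      fun s u hs hu hsu => ?_⟩
    · rcases (hX v hv c hc).1 h with h | h
      · exact (hS v hv).2 (Or.inl (hpm v hv c hc h))
      · exact h.1
    · have hsn := hsu.1
      have hun := hsu.2.1
      obtain ⟨hmu, hcu⟩ := hS0 u hun hu
      refine (hX s hsn _ (hrp u hun)).2 ?_
      by_cases hms : mk s = 0
      · right
        refine ⟨hs, (hrepiff s hsn u hun hms hmu ?_).1 hsu⟩
        rintro rfl
        exact hs hu
      · left
        -- Here the gap is used: `u` is not in the cover, so the price is at least `g`; not being
        -- equal to `g`, it exceeds `g` and the pair is chosen.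
        have h1 : ¬ p (s * n + rp u) < g := fun h => hcu ⟨hmu, s, hms, hsu, h⟩
        have h2 := hgap.2.2 s hsn _ (hrp u hun)
        omega
  obtain ⟨m, H, σ, h1, h2, h3, h4⟩ := hD.exists_splitSeq hG
  refine ⟨m, H, σ, by rw [h4]; exact hout, h2, h3, fun m' H' τ hτ => ?_⟩
  classical
  set A := (Finset.range n).filter (mk · ≠ 0) with hA
  set M := (Finset.range n).filter (mate · ≠ 0) with hM
  set T := (Finset.range n).filter (InCover G mk rp p g) with hT
  set Q := (Finset.range (n * n)).filter (g < p ·) with hQ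
  have hcover : T.card + Q.card ≤ M.card := by
    refine hinv.card_cover_le hsat hgap T Q (fun a ha => ?_) (fun q hq => ?_)
    · rw [hT, Finset.mem_filter, Finset.mem_range] at ha
      exact ha
    · rw [hQ, Finset.mem_filter, Finset.mem_range] at hq
      have hn : 0 < n := Nat.pos_of_ne_zero fun h => by simp [h] at hq
      exact ⟨q / n, Nat.div_lt_of_lt_mul hq.1, q % n, Nat.mod_lt _ hn,
        (Nat.div_add_mod' q n).symm, hq.2⟩
  have hlen : (PairData.positions n X).length ≤ A.card + T.card + Q.card := by
    -- A chosen pair is either dear or the home pair of a split vertex, and a home pair is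
    -- determined by its vertex.
    have hsub : (PairData.positions n X).toFinset ⊆ (A ∪ T).image (fun a => a * n + rp a) ∪ Q := by
      intro q hq
      rw [List.mem_toFinset, PairData.mem_positions] at hq
      obtain ⟨hqn, hXq⟩ := hq
      have hn : 0 < n := Nat.pos_of_ne_zero fun h => by simp [h] at hqn
      have hv := Nat.div_lt_of_lt_mul hqn
      have h5 := (hX (q / n) hv (q % n) (Nat.mod_lt _ hn)).1 (by rwa [Nat.div_add_mod'])
      rw [Nat.div_add_mod'] at h5
      rw [Finset.mem_union]
      rcases h5 with h5 | ⟨h5, h6⟩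
      · exact Or.inr (Finset.mem_filter.2 ⟨Finset.mem_range.2 hqn, h5⟩)
      · refine Or.inl (Finset.mem_image.2 ⟨q / n, ?_, by rw [h6, Nat.div_add_mod']⟩)
        rw [Finset.mem_union, hA, hT, Finset.mem_filter, Finset.mem_filter, Finset.mem_range]
        exact ((hS _ hv).1 h5).imp (fun h => ⟨hv, h⟩) (fun h => ⟨hv, h⟩)
    have h5 := Finset.card_le_card hsub
    rw [List.toFinset_card_of_nodup (PairData.pairwise_positions.imp fun h => h.ne)] at h5
    have h6 := Finset.card_union_le ((A ∪ T).image (fun a => a * n + rp a)) Q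
    have h7 : ((A ∪ T).image (fun a => a * n + rp a)).card ≤ (A ∪ T).card := Finset.card_image_le
    have h8 := Finset.card_union_le A T
    omega
  have hlow := lower_bound hG τ hτ A M (Finset.filter_subset _ _) (Finset.filter_subset _ _)
    (by
      rw [Finset.disjoint_left]
      intro a ha ha'
      obtain ⟨v, hv⟩ := Nat.exists_eq_succ_of_ne_zero (Finset.mem_filter.1 ha').2
      exact (Finset.mem_filter.1 ha).2 (hinv.mate_spec a v hv).1)
    hpack (fun a => mate a - 1)
    (fun a ha => by
      obtain ⟨v, hv⟩ := Nat.exists_eq_succ_of_ne_zero (Finset.mem_filter.1 ha).2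
      obtain ⟨-, h5, h6⟩ := hinv.mate_spec a v hv
      rw [hv]
      exact ⟨Finset.mem_filter.2 ⟨Finset.mem_range.2 h6.1, h5⟩, h6⟩)
    -- Blue adjacent unmarked vertices share a cluster, so with a common mate they would own the
    -- same pair.
    (fun a ha b hb hab hbl => by
      have ha' := (Finset.mem_filter.1 ha).2
      have hb' := (Finset.mem_filter.1 hb).2
      obtain ⟨v, hv⟩ := Nat.exists_eq_succ_of_ne_zero ha'
      obtain ⟨w, hw⟩ := Nat.exists_eq_succ_of_ne_zero hb'
      have hne : a ≠ b := by
        rintro rfl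
        exact CorrelationGraph.bl_irrefl hbl
      refine hne (hinv.inj a b ha' (by omega) ?_)
      exact (hrepiff a hbl.1 b hbl.2.1 (hinv.mate_spec a v hv).1 (hinv.mate_spec b w hw).1 hne).1 hbl)
  omega

end PVS

theorem mainTheorem2 :
    ∃ (P : PVS.Program) (p : Polynomial ℕ),
      ∀ (n : ℕ) (G : PVS.CorrelationGraph n), G.IsComplete →
        ∃ (t : ℕ) (s : PVS.Mem) (m : ℕ) (H : PVS.CorrelationGraph m) (σ : PVS.SplitSeq G H),
          PVS.Run P (PVS.Mem.init G.encode) t s ∧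
          t ≤ p.eval n ∧
          s.Outputs σ.encode ∧
          σ.StaysComplete ∧
          σ.Clusters ∧
          ∀ (m' : ℕ) (H' : PVS.CorrelationGraph m') (τ : PVS.SplitSeq G H'),
            τ.Clusters → σ.length ≤ 7 * τ.length := by
  refine ⟨PVS.mainCmd.compile, PVS.mainCmd.time, fun n G hG => ?_⟩
  obtain ⟨t, h1, h2⟩ := PVS.mainCmd.exists_run (by decide) (PVS.Mem.init G.encode)
  obtain ⟨m, H, σ, h3, h4, h5, h6⟩ := PVS.mainCmd_spec G hG
  exact ⟨t, _, m, H, σ, h1, h2, h3, h4, h5, h6⟩
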